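/- Let $n\ge 1$ be an integer, $c,a_0,\lambda,r_0>0$, $1<p<\infty$, $0<\theta<1$, $\sigma,H\in\mathbb R$, $m\in i\mathbb R$. Put $$a(t)=\begin{cases}a_0e^{Ht}&\text{if }\sigma=-1,\\ a_0\left\{1+\frac{n(1+\sigma)Ht}{2}\right\}^{2/(n(1+\sigma))}&\text{if }\sigma\neq-1,\end{cases}\qquad M^2=m^2-\frac{n(n-2)}{4c^2}\Big(\frac{\dot a}{a}\Big)^2-\frac{n}{2c^2}\frac{\ddot a}{a},\quad M=\sqrt{M^2},$$ $r(t)=r_0+\int_0^t\frac{c}{a(s)}\,ds$ (in each of the cases (1)–(3) below $a$ is positive and smooth on $[0,\infty)$). Let $u_0,u_1\in L^1(\mathbb R^n;\mathbb C)$ vanish almost everywhere outside $\{|x|\le r_0\}$, and put $w_j=\operatorname{Re}\int_{\mathbb R^n}u_j\,dx$ for $j=0,1$. Let $\omega_n$ be the volume of the unit ball of $\mathbb R^n$, and, for the number $N\ge0$ given in (1)–(3) below, put $$b=\frac{\lambda}{\omega_n^{p-1}(ar^2)^{n(p-1)/2}},\qquad S=\sup_{0<t<\infty}\left\{e^{-cNt}\left(\frac{N^2+M^2(t)}{(1-\theta)b(t)}\right)^{1/(p-1)}\right\}.$$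 Assume $S<\infty$, $w_0>S$ and $w_1\ge cNw_0$. Consider the Cauchy problem $$\left(c^{-2}\partial_t^2-a^{-2}\Delta+M^2\right)u-\lambda a^{-n(p-1)/2}|u|^p=0,\qquad u(0,\cdot)=u_0,\quad \partial_tu(0,\cdot)=u_1 .$$ A global weak solution is a function $u\in L^1_{\rm loc}([0,\infty)\times\mathbb R^n;\mathbb C)$ such that $h:=-\lambda a^{-n(p-1)/2}|u|^p\in L^1_{\rm loc}([0,\infty)\times\mathbb R^n)$, such that $$c^{-2}\!\int u_0\,\partial_t\psi(0,x)\,dx-c^{-2}\!\int u_1\,\psi(0,x)\,dx+\int_0^\infty\!\!\int u\left\{c^{-2}\partial_t^2\psi-a^{-2}\Delta\psi+M^2\psi\right\}dx\,dt+\int_0^\infty\!\!\int h\,\psi\,dx\,dt=0$$ for every $\psi\in C^2_0([0,\infty)\times\mathbb R^n)$, and such that $u(t,x)=0$ for almost every $(t,x)$ with $t\ge0$, $|x|>r(t)$ (finite speed of propagation). Then no global weak solution exists that is nontrivial (not almost everywhere $0$ on $[0,\infty)\times\mathbb R^n$), provided that one of the following conditions holds. (1) $H=0$, $N=|m|$,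 and $1<p<\infty$ if $n=1$, $1<p<1+\frac{2}{n-1}$ if $n\ge2$. (2) $H>0$, $\sigma>-1$; $|m|\ge\frac{\sqrt\sigma\,nH}{2c}$ and $N=|m|$ if $\sigma>0$; $N=|m|$ if $\sigma=0$; $N=\sqrt{-m^2-\sigma(nH/2c)^2}$ if $-1<\sigma<0$; and $$1<p<\begin{cases}\infty&\text{if }n=1,\ \sigma\ge0,\\ \infty&\text{if }n=2,\ \sigma=-1+\frac2n,\\ \frac{(n+1)(1+\sigma)-1}{(n-1)(1+\sigma)-1}&\text{if }n\ge2,\ \sigma>-1+\frac2n,\\ \frac{n+2}{n-2}&\text{if }n\ge3,\ \sigma=-1+\frac2n,\\ -\frac{2+\sigma}{\sigma}&\text{if }n=1,\ -1<\sigma<0,\\ -\frac{2+\sigma}{\sigma}&\text{if }n\ge2,\ -1<\sigma<-1+\frac2n.\end{cases}$$ (3) $H<0$, $\sigma<-1-\frac2n$, $N=\sqrt{-m^2-\sigma(nH/2c)^2}$, and $$1<p<p_0:=\frac{n\{(n+1)(\sigma+1)+1\}}{n(n-1)(\sigma+1)+n-4}.$$ -/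

import Mathlib

open MeasureTheory Set
open scoped Laplacian

noncomputable section

namespace FLRW

/-- The space `ℝⁿ` with its Euclidean norm. -/
abbrev Space (n : ℕ) : Type := EuclideanSpace ℝ (Fin n)

/-- The scale function `a` with `a(0) = a₀` and Hubble constant `H`. -/
def scale (n : ℕ) (σ H a₀ t : ℝ) : ℝ :=
  if σ = -1 then a₀ * Real.exp (H * t)
  else a₀ * (1 + n * (1 + σ) * H * t / 2) ^ (2 / (n * (1 + σ)))

/-- The square `M²` of the curved mass of a scale function `a`, for a mass `m` in `ℂ`;
it is real when `m` is real or purely imaginary. -/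
def curvedMassSq (n : ℕ) (c : ℝ) (m : ℂ) (a : ℝ → ℝ) (t : ℝ) : ℂ :=
  m ^ 2 - ((n * (n - 2) / (4 * c ^ 2) * (deriv a t / a t) ^ 2 : ℝ) : ℂ)
    - ((n / (2 * c ^ 2) * (iteratedDeriv 2 a t / a t) : ℝ) : ℂ)

/-- The curved mass `M = √(M²)` (principal square root). -/
def curvedMass (n : ℕ) (c : ℝ) (m : ℂ) (a : ℝ → ℝ) (t : ℝ) : ℂ :=
  (curvedMassSq n c m a t) ^ (1 / 2 : ℂ)

/-- `r(t) = r₀ + ∫₀ᵗ c / a(s) ds`. -/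
def radius (c r₀ : ℝ) (a : ℝ → ℝ) (t : ℝ) : ℝ :=
  r₀ + ∫ s in (0 : ℝ)..t, c / a s

/-- The volume `ω_n` of the unit ball of `ℝⁿ`. -/
def unitBallVolume (n : ℕ) : ℝ :=
  (volume : Measure (Space n)).real (Metric.ball 0 1)

/-- `b = lam / (ω_n ^ (p - 1) (a r²) ^ (n (p - 1) / 2))`. -/
def coeffB (n : ℕ) (c lam p r₀ : ℝ) (a : ℝ → ℝ) (t : ℝ) : ℝ :=
  lam / (unitBallVolume n ^ (p - 1)
    * (a t * radius c r₀ a t ^ 2) ^ (n * (p - 1) / 2))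

/-- The function of `t` whose supremum over `0 < t < ∞` is `S`. -/
def thresholdFun (n : ℕ) (c lam p r₀ N θ : ℝ) (m : ℂ) (a : ℝ → ℝ) (t : ℝ) : ℝ :=
  Real.exp (-(c * N * t)) *
    ((N ^ 2 + (curvedMass n c m a t ^ 2).re) / ((1 - θ) * coeffB n c lam p r₀ a t))
      ^ (1 / (p - 1))

/-- The set of values over `0 < t < ∞` whose supremum is `S`. -/
def thresholdSet (n : ℕ) (c lam p r₀ N θ : ℝ) (m : ℂ) (a : ℝ → ℝ) : Set ℝ :=
  thresholdFun n c lam p r₀ N θ m a '' Ioi 0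

/-- `[0,∞) × ℝⁿ`. -/
def halfSpace (n : ℕ) : Set (ℝ × Space n) := Ici 0 ×ˢ univ

/-- `u` is a weak global solution of
`c⁻² ∂ₜ²u - a⁻² Δu + M² u + h = 0`, `u(0,·) = u₀`, `∂ₜu(0,·) = u₁`, with `u` and `h` in
`L¹_loc([0,∞) × ℝⁿ)`. The test functions on `[0,∞) × ℝⁿ` are the restrictions of the compactly supported `C²` functions
on `ℝ × ℝⁿ`. Since the identity is linear in `ψ`, real-valued test functions suffice. -/
structure IsWeakGlobalSolution (n : ℕ) (c : ℝ) (a : ℝ → ℝ) (M : ℝ → ℂ)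
    (h : ℝ × Space n → ℂ) (u₀ u₁ : Space n → ℂ) (u : ℝ × Space n → ℂ) : Prop where
  locallyIntegrable : LocallyIntegrableOn u (halfSpace n)
  locallyIntegrable_force : LocallyIntegrableOn h (halfSpace n)
  weak_eq : ∀ ψ : ℝ × Space n → ℝ, ContDiff ℝ 2 ψ → HasCompactSupport ψ →
    ((c ^ 2)⁻¹ : ℂ) * (∫ x, u₀ x * (deriv (fun s => ψ (s, x)) 0 : ℝ))
      - ((c ^ 2)⁻¹ : ℂ) * (∫ x, u₁ x * (ψ (0, x) : ℝ))
      + (∫ t in Ioi (0 : ℝ), ∫ x, u (t, x) *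
          (((c ^ 2)⁻¹ : ℂ) * (iteratedDeriv 2 (fun s => ψ (s, x)) t : ℝ)
            - ((a t ^ 2)⁻¹ : ℂ) * ((Δ (fun y => ψ (t, y))) x : ℝ)
            + M t ^ 2 * (ψ (t, x) : ℝ)))
      + (∫ t in Ioi (0 : ℝ), ∫ x, h (t, x) * (ψ (t, x) : ℝ)) = 0

/-- The term `h = -lam a^{-n(p-1)/2} |u|^p` of the semilinear equation. -/
def force (n : ℕ) (lam p : ℝ) (a : ℝ → ℝ) (u : ℝ × Space n → ℂ) (z : ℝ × Space n) : ℂ :=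
  ((-(lam * a z.1 ^ (-(n * (p - 1) / 2)) * ‖u z‖ ^ p) : ℝ) : ℂ)

/-- Finite speed of propagation: `u(t,x) = 0` for almost every `(t,x)` with `t ≥ 0`,
`|x| > r(t)`. -/
def HasFiniteSpeed (n : ℕ) (c r₀ : ℝ) (a : ℝ → ℝ) (u : ℝ × Space n → ℂ) : Prop :=
  ∀ᵐ z ∂(volume.restrict (halfSpace n)), radius c r₀ a z.1 < ‖z.2‖ → u z = 0

/-- `u` is a weak solution, on `[0,∞) × ℝⁿ` and with finite speed of propagation, of
`c⁻² ∂ₜ²u - a⁻² Δu + M² u - lam a^{-n(p-1)/2} |u|^p = 0`, `u(0,·) = u₀`, `∂ₜu(0,·) = u₁`,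
where `M` is the curved mass of `a` and `m`. -/
def IsGlobalSolution (n : ℕ) (c lam p r₀ : ℝ) (m : ℂ) (a : ℝ → ℝ) (u₀ u₁ : Space n → ℂ)
    (u : ℝ × Space n → ℂ) : Prop :=
  IsWeakGlobalSolution n c a (curvedMass n c m a) (force n lam p a u) u₀ u₁ u ∧
    HasFiniteSpeed n c r₀ a u

/-- Condition (1): constant scale function. -/
def CaseStatic (n : ℕ) (H p N : ℝ) (m : ℂ) : Prop :=
  H = 0 ∧ m.re = 0 ∧ N = ‖m‖ ∧ 1 < p ∧
    (n = 1 ∨ 2 ≤ n ∧ p < 1 + 2 / ((n : ℝ) - 1))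

/-- Condition (2): expanding space. -/
def CaseExpanding (n : ℕ) (c σ H p N : ℝ) (m : ℂ) : Prop :=
  0 < H ∧ -1 < σ ∧ m.re = 0 ∧
    (0 < σ ∧ √σ * n * H / (2 * c) ≤ ‖m‖ ∧ N = ‖m‖ ∨
      σ = 0 ∧ N = ‖m‖ ∨
      σ < 0 ∧ N = √(-(m ^ 2).re - σ * (n * H / (2 * c)) ^ 2)) ∧
    1 < p ∧
    (n = 1 ∧ 0 ≤ σ ∨
      n = 2 ∧ σ = -1 + 2 / (n : ℝ) ∨
      2 ≤ n ∧ -1 + 2 / (n : ℝ) < σ ∧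
        p < (((n : ℝ) + 1) * (1 + σ) - 1) / (((n : ℝ) - 1) * (1 + σ) - 1) ∨
      3 ≤ n ∧ σ = -1 + 2 / (n : ℝ) ∧ p < ((n : ℝ) + 2) / ((n : ℝ) - 2) ∨
      n = 1 ∧ σ < 0 ∧ p < -((2 + σ) / σ) ∨
      2 ≤ n ∧ σ < -1 + 2 / (n : ℝ) ∧ p < -((2 + σ) / σ))

/-- Condition (3): contracting space. -/
def CaseContracting (n : ℕ) (c σ H p N : ℝ) (m : ℂ) : Prop :=
  H < 0 ∧ σ < -1 - 2 / (n : ℝ) ∧ m.re = 0 ∧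
    N = √(-(m ^ 2).re - σ * (n * H / (2 * c)) ^ 2) ∧
    1 < p ∧
    p < (n * (((n : ℝ) + 1) * (σ + 1) + 1)) / (n * ((n : ℝ) - 1) * (σ + 1) + n - 4)

end FLRW

end

/-! Averaging in space turns the equation into an ordinary differential inequality. By finite speed
of propagation `u(t, ·)` lives in the ball of radius `r(t)`, so test functions equal to `φ(t)` near
that ball see no Laplacian, and `W = Re ∫ u dx` satisfies weakly `W'' = c² (-F - M² W)` with `F = Re
∫ h dx` (`averaged_weak_eq`). Hölder's inequality on the ball gives `-F ≥ b |W|^p`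
(`coeffB_mul_rpow_le`).

The number `S` is such that `W ≥ S e^{cNt}` forces `(N² + M²) W ≤ (1 - θ) b W^p`
(`thresholdFun_absorb`); what remains is `W'' ≥ ν² W + c² θ b W^p` with `ν = cN`. As `w₀ > S` and
`w₁ ≥ ν w₀`, a continuity argument keeps `W ≥ w₀ e^{νt}` for all time
(`secondPrimitive_ge_of_threshold`). Since `u` is only locally integrable, `W` is first identified
almost everywhere with a `C¹` second primitive, to which such arguments apply
(`ae_eq_secondPrimitive`).

Finally `b` decays at most like a power `(1 + t)^{-k}`, and testing with `e^{-νt} (1 - t/T)^l`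
bounds a fixed positive constant by a negative power of `T` (`false_of_secondPrimitive_ineq`). If `ν
> 0` the factor `e^{-νt}` beats every `k`; if `ν = 0` one needs `k < p + 1`, which the admissible
dimensions and exponents guarantee (`pos_or_subcritical_of_case`). -/

noncomputable section

open Filter Topology

namespace FLRW

/-! ### Weak solutions of `w'' = G` on the half-line. -/

/-- `y(t) = w₁ + ∫₀ᵗ G`. -/
def firstPrimitive (G : ℝ → ℝ) (w₁ t : ℝ) : ℝ := w₁ + ∫ s in (0 : ℝ)..t, G s

/-- `z(t) = w₀ + ∫₀ᵗ (w₁ + ∫₀ˢ G) ds`. -/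
def secondPrimitive (G : ℝ → ℝ) (w₀ w₁ t : ℝ) : ℝ :=
  w₀ + ∫ s in (0 : ℝ)..t, firstPrimitive G w₁ s

theorem intervalIntegrable_of_locallyIntegrable {G : ℝ → ℝ} (hG : LocallyIntegrable G) (a b : ℝ) :
    IntervalIntegrable G volume a b :=
  (hG.integrableOn_isCompact isCompact_uIcc).intervalIntegrable

theorem continuous_firstPrimitive {G : ℝ → ℝ} (hG : LocallyIntegrable G) (w₁ : ℝ) :
    Continuous (firstPrimitive G w₁) :=
  continuous_const.add
    (intervalIntegral.continuous_primitive (intervalIntegrable_of_locallyIntegrable hG) 0)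

theorem hasDerivAt_secondPrimitive {G : ℝ → ℝ} (hG : LocallyIntegrable G) (w₀ w₁ t : ℝ) :
    HasDerivAt (secondPrimitive G w₀ w₁) (firstPrimitive G w₁ t) t :=
  ((continuous_firstPrimitive hG w₁).integral_hasStrictDerivAt 0 t).hasDerivAt.const_add w₀

theorem continuous_secondPrimitive {G : ℝ → ℝ} (hG : LocallyIntegrable G) (w₀ w₁ : ℝ) :
    Continuous (secondPrimitive G w₀ w₁) :=
  continuous_iff_continuousAt.2 fun t => (hasDerivAt_secondPrimitive hG w₀ w₁ t).continuousAt

theorem firstPrimitive_sub {G : ℝ → ℝ} (hG : LocallyIntegrable G) (w₁ s t : ℝ) :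
    firstPrimitive G w₁ t - firstPrimitive G w₁ s = ∫ r in s..t, G r := by
  have h := intervalIntegrable_of_locallyIntegrable hG
  simp only [firstPrimitive, add_sub_add_left_eq_sub]
  exact intervalIntegral.integral_interval_sub_left (h _ _) (h _ _)

/-- Integration by parts for absolutely continuous functions: `G` is only locally integrable, so the
primitive has derivative `G` merely almost everywhere. -/
theorem integral_firstPrimitive_mul_deriv {G : ℝ → ℝ} (hG : LocallyIntegrable G) (w₁ : ℝ)
    {f : ℝ → ℝ} (hf : ContDiff ℝ 1 f) (T : ℝ) :
    ∫ t in (0 : ℝ)..T, firstPrimitive G w₁ t * deriv f t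
      = firstPrimitive G w₁ T * f T - w₁ * f 0 - ∫ t in (0 : ℝ)..T, G t * f t := by
  have hI := intervalIntegrable_of_locallyIntegrable hG 0 T
  have hy0 := hI.absolutelyContinuousOnInterval_intervalIntegral (c := 0) (by simp)
  have hfa : AbsolutelyContinuousOnInterval f 0 T :=
    hf.contDiffOn.absolutelyContinuousOnInterval
  have h := hy0.integral_mul_deriv_eq_deriv_mul hfa
  have hfd : Continuous (deriv f) := hf.continuous_deriv le_rfl
  have h2 : ∫ x in (0 : ℝ)..T, deriv (fun x => ∫ v in (0 : ℝ)..x, G v) x * f x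
      = ∫ t in (0 : ℝ)..T, G t * f t := by
    apply intervalIntegral.integral_congr_ae
    filter_upwards [_root_.LocallyIntegrable.ae_hasDerivAt_integral hG] with x hx _
    rw [(hx 0).deriv]
  have h3 : ∫ t in (0 : ℝ)..T, deriv f t = f T - f 0 :=
    hfa.integral_deriv_eq_sub
  simp only [firstPrimitive, add_mul]
  have hc : Continuous fun x => ∫ v in (0 : ℝ)..x, G v :=
    intervalIntegral.continuous_primitive (intervalIntegrable_of_locallyIntegrable hG) 0
  rw [intervalIntegral.integral_add ((continuous_const.fun_mul hfd).intervalIntegrable _ _)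
    ((hc.fun_mul hfd).intervalIntegrable _ _), h, h2, intervalIntegral.integral_const_mul, h3]
  simp
  ring

theorem integral_secondPrimitive_mul_deriv_deriv {G : ℝ → ℝ} (hG : LocallyIntegrable G)
    (w₀ w₁ : ℝ) {f : ℝ → ℝ} (hf : ContDiff ℝ 2 f) (T : ℝ) :
    ∫ t in (0 : ℝ)..T, secondPrimitive G w₀ w₁ t * deriv (deriv f) t
      = secondPrimitive G w₀ w₁ T * deriv f T - w₀ * deriv f 0
        - (firstPrimitive G w₁ T * f T - w₁ * f 0 - ∫ t in (0 : ℝ)..T, G t * f t) := by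
  have hf' : ContDiff ℝ 1 (deriv f) := ContDiff.deriv' (n := 1) (by rwa [one_add_one_eq_two])
  rw [← integral_firstPrimitive_mul_deriv hG w₁ (hf.of_le (by norm_num))]
  have h := integral_firstPrimitive_mul_deriv
    (continuous_firstPrimitive hG w₁).locallyIntegrable w₀ hf' T
  have e : firstPrimitive (firstPrimitive G w₁) w₀ = secondPrimitive G w₀ w₁ := rfl
  rw [e] at h
  exact h

/-- A distribution on `[0,∞)` with `w'' = G`, `w(0) = w₀`, `w'(0) = w₁` is the second primitive
of `G`. -/
theorem ae_eq_secondPrimitive {w G : ℝ → ℝ} {w₀ w₁ : ℝ} (hw : LocallyIntegrable w)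
    (hG : LocallyIntegrable G)
    (hweak : ∀ φ : ℝ → ℝ, ContDiff ℝ 2 φ → ∀ T > 0, (∀ t ≥ T, φ t = 0) →
      ∫ t in (0 : ℝ)..T, w t * deriv (deriv φ) t
        = (∫ t in (0 : ℝ)..T, G t * φ t) - w₀ * deriv φ 0 + w₁ * φ 0) :
    ∀ᵐ t, t ∈ Ioi (0 : ℝ) → w t = secondPrimitive G w₀ w₁ t := by
  set z := secondPrimitive G w₀ w₁ with hz
  have hzc : Continuous z := continuous_secondPrimitive hG w₀ w₁
  have key : ∀ᵐ t, t ∈ Ioi (0 : ℝ) → (w t - z t) = 0 := by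
    apply isOpen_Ioi.ae_eq_zero_of_integral_contDiff_smul_eq_zero
    · exact (hw.sub hzc.locallyIntegrable).locallyIntegrableOn _
    intro g hg hgc hgs
    obtain ⟨R, hR⟩ := hgc.isCompact.isBounded.subset_closedBall (0 : ℝ)
    set T : ℝ := |R| + 1 with hT
    have hTpos : 0 < T := by positivity
    have hg0 : ∀ t, t ∉ Ioc 0 T → g t = 0 := by
      intro t ht
      by_contra hne
      have hts : t ∈ tsupport g := subset_tsupport g hne
      apply ht
      refine ⟨hgs hts, ?_⟩
      have := hR hts
      rw [mem_closedBall_zero_iff, Real.norm_eq_abs] at this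
      linarith [le_abs_self t, le_abs_self R]
    have hgcont := hg.continuous
    -- Integrating `g` twice from `T` gives `φ'' = g` with `φ = 0` beyond `T`. Nothing is imposed on
    -- `φ` at `0`, so the initial data enter through `φ 0` and `φ' 0`, and cancel against those of
    -- `z`.
    let P : ℝ → ℝ := fun t => ∫ s in T..t, g s
    let φ : ℝ → ℝ := fun t => ∫ s in T..t, P s
    have hPd : ∀ t, HasDerivAt P (g t) t := fun t =>
      (hgcont.integral_hasStrictDerivAt T t).hasDerivAt
    have hPc : Continuous P := continuous_iff_continuousAt.2 fun t => (hPd t).continuousAt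
    have hφd : ∀ t, HasDerivAt φ (P t) t := fun t =>
      (hPc.integral_hasStrictDerivAt T t).hasDerivAt
    have hφ' : deriv φ = P := funext fun t => (hφd t).deriv
    have hP' : deriv P = g := funext fun t => (hPd t).deriv
    have hP1 : ContDiff ℝ 1 P := by
      rw [contDiff_one_iff_deriv]
      exact ⟨fun t => (hPd t).differentiableAt, hP'.symm ▸ hgcont⟩
    have hφ2 : ContDiff ℝ 2 φ := by
      have : ContDiff ℝ (1 + 1) φ := by
        rw [contDiff_succ_iff_deriv]
        exact ⟨fun t => (hφd t).differentiableAt, by simp, hφ'.symm ▸ hP1⟩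
      simpa [one_add_one_eq_two] using this
    have hPT : ∀ t ≥ T, P t = 0 := by
      intro t ht
      refine (intervalIntegral.integral_congr_ae (g := fun _ => (0 : ℝ)) ?_).trans (by simp)
      refine Eventually.of_forall fun s hs => hg0 s fun h => ?_
      rw [uIoc_of_le ht] at hs
      exact absurd h.2 (not_le.2 hs.1)
    have hφT : ∀ t ≥ T, φ t = 0 := by
      intro t ht
      refine (intervalIntegral.integral_congr_ae (g := fun _ => (0 : ℝ)) ?_).trans (by simp)
      refine Eventually.of_forall fun s hs => hPT s ?_
      rw [uIoc_of_le ht] at hs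
      exact hs.1.le
    have h1 := hweak φ hφ2 T hTpos hφT
    have h2 := integral_secondPrimitive_mul_deriv_deriv hG w₀ w₁ hφ2 T
    rw [hφ', hP'] at h1 h2
    rw [hPT T le_rfl, hφT T le_rfl] at h2
    have h3 : ∫ x, g x • (w x - z x) = ∫ x in (0 : ℝ)..T, g x * (w x - z x) := by
      rw [intervalIntegral.integral_of_le hTpos.le,
        setIntegral_eq_integral_of_forall_compl_eq_zero]
      · rfl
      · intro x hx
        rw [hg0 x hx, zero_mul]
    rw [h3]
    have h4 : ∀ x, g x * (w x - z x) = w x * g x - z x * g x := fun x => by ring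
    simp only [h4]
    rw [intervalIntegral.integral_sub
      ((intervalIntegrable_of_locallyIntegrable hw _ _).mul_continuousOn hgcont.continuousOn)
      ((hzc.fun_mul hgcont).intervalIntegrable _ _), h1, h2]
    ring
  filter_upwards [key] with t ht h0
  linarith [ht h0]

/-! ### Exponential lower bound above the threshold. -/

/-- Let `s` be the last time before a failure at `t₁` with `ν z ≤ y`. On `(s, t₁]` one has `ν y ≤ ν²
z ≤ G`, so `y - ν z` does not decrease there, which contradicts its becoming negative. -/
theorem firstPrimitive_ge_of_threshold {G B : ℝ → ℝ} (hG : LocallyIntegrable G) {ν p S w₀ w₁ : ℝ}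
    (hν : 0 ≤ ν) (hS : 0 ≤ S) (hw₁ : ν * w₀ ≤ w₁) (hB : ∀ t, 0 ≤ t → 0 ≤ B t)
    (hineq : ∀ᵐ t, t ∈ Ioi (0 : ℝ) → S * Real.exp (ν * t) ≤ secondPrimitive G w₀ w₁ t →
      ν ^ 2 * secondPrimitive G w₀ w₁ t + B t * secondPrimitive G w₀ w₁ t ^ p ≤ G t)
    {T : ℝ} (hT : ∀ t ∈ Icc 0 T, S * Real.exp (ν * t) ≤ secondPrimitive G w₀ w₁ t) :
    ∀ t ∈ Icc 0 T, ν * secondPrimitive G w₀ w₁ t ≤ firstPrimitive G w₁ t := by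
  intro t₁ ht₁
  by_contra! hneg
  set z := secondPrimitive G w₀ w₁ with hz
  set y := firstPrimitive G w₁ with hy
  have hzc : Continuous z := continuous_secondPrimitive hG w₀ w₁
  have hyc : Continuous y := continuous_firstPrimitive hG w₁
  have hz0 : z 0 = w₀ := by simp [hz, secondPrimitive]
  have hy0 : y 0 = w₁ := by simp [hy, firstPrimitive]
  let A : Set ℝ := Icc 0 t₁ ∩ {s | ν * z s ≤ y s}
  have hAc : IsCompact A :=
    isCompact_Icc.inter_right (isClosed_le (hzc.const_mul ν) hyc)
  have hAne : A.Nonempty := ⟨0, ⟨le_rfl, ht₁.1⟩, by simpa [hz0, hy0] using hw₁⟩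
  obtain ⟨s, hsA, hsmax⟩ := hAc.exists_isGreatest hAne
  have hst : s ≤ t₁ := hsA.1.2
  have hlt : ∀ r ∈ Ioc s t₁, y r < ν * z r := by
    intro r hr
    by_contra! h
    exact absurd (hsmax ⟨⟨hsA.1.1.trans hr.1.le, hr.2⟩, h⟩) (not_le.2 hr.1)
  have h1 := firstPrimitive_sub hG w₁ s t₁
  have h2 : z t₁ - z s = ∫ r in s..t₁, y r :=
    (intervalIntegral.integral_eq_sub_of_hasDerivAt
      (fun r _ => hasDerivAt_secondPrimitive hG w₀ w₁ r) (hyc.intervalIntegrable _ _)).symm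
  have h3 : ν * (z t₁ - z s) ≤ y t₁ - y s := by
    rw [h1, h2, ← intervalIntegral.integral_const_mul]
    apply intervalIntegral.integral_mono_ae_restrict hst
      ((hyc.const_mul ν).intervalIntegrable _ _) (intervalIntegrable_of_locallyIntegrable hG _ _)
    rw [EventuallyLE, ae_restrict_iff' measurableSet_Icc]
    filter_upwards [hineq, Measure.ae_ne volume s] with r hr hrs hrmem
    have hr0 : 0 < r := hsA.1.1.trans_lt (lt_of_le_of_ne hrmem.1 (Ne.symm hrs))
    have hzS := hT r ⟨hr0.le, hrmem.2.trans ht₁.2⟩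
    have hz0 : 0 ≤ z r := le_trans (by positivity) hzS
    have hyr := hlt r ⟨lt_of_le_of_ne hrmem.1 (Ne.symm hrs), hrmem.2⟩
    have h5 := hr hr0 hzS
    have h6 : 0 ≤ B r * z r ^ p := mul_nonneg (hB r hr0.le) (Real.rpow_nonneg hz0 p)
    have h7 : ν * y r ≤ ν * (ν * z r) := mul_le_mul_of_nonneg_left hyr.le hν
    nlinarith
  have h4 : ν * z s ≤ y s := hsA.2
  nlinarith

/-- Continuity argument: while `z ≥ S e^{νt}` the bound `z' ≥ ν z` makes `z e^{-νt}` nondecreasing,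
hence at least `w₀ > S`. The threshold can therefore never be reached from above. -/
theorem secondPrimitive_ge_of_threshold {G B : ℝ → ℝ} (hG : LocallyIntegrable G) {ν p S w₀ w₁ : ℝ}
    (hν : 0 ≤ ν) (hS : 0 ≤ S) (hSw : S < w₀) (hw₁ : ν * w₀ ≤ w₁) (hB : ∀ t, 0 ≤ t → 0 ≤ B t)
    (hineq : ∀ᵐ t, t ∈ Ioi (0 : ℝ) → S * Real.exp (ν * t) ≤ secondPrimitive G w₀ w₁ t →
      ν ^ 2 * secondPrimitive G w₀ w₁ t + B t * secondPrimitive G w₀ w₁ t ^ p ≤ G t)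
    {t : ℝ} (ht : 0 ≤ t) : w₀ * Real.exp (ν * t) ≤ secondPrimitive G w₀ w₁ t := by
  set z := secondPrimitive G w₀ w₁ with hz
  have hzc : Continuous z := continuous_secondPrimitive hG w₀ w₁
  have hz0 : z 0 = w₀ := by simp [hz, secondPrimitive]
  have step : ∀ T, 0 ≤ T → (∀ t ∈ Icc 0 T, S * Real.exp (ν * t) ≤ z t) →
      w₀ * Real.exp (ν * T) ≤ z T := by
    intro T hT0 hT
    have hy := firstPrimitive_ge_of_threshold hG hν hS hw₁ hB hineq hT
    have hd : ∀ t, HasDerivAt (fun t => z t * Real.exp (-(ν * t)))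
        ((firstPrimitive G w₁ t - ν * z t) * Real.exp (-(ν * t))) t := by
      intro t
      have h1 : HasDerivAt (fun t : ℝ => Real.exp (-(ν * t))) (Real.exp (-(ν * t)) * (-(ν * 1))) t :=
        (((hasDerivAt_id t).const_mul ν).neg).exp
      refine ((hasDerivAt_secondPrimitive hG w₀ w₁ t).fun_mul h1).congr_deriv ?_
      ring
    have hmono : MonotoneOn (fun t => z t * Real.exp (-(ν * t))) (Icc 0 T) := by
      apply monotoneOn_of_deriv_nonneg (convex_Icc 0 T)
      · exact fun t _ => (hd t).continuousAt.continuousWithinAt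
      · exact fun t _ => (hd t).differentiableAt.differentiableWithinAt
      · intro t ht
        rw [interior_Icc] at ht
        rw [(hd t).deriv]
        exact mul_nonneg (sub_nonneg.2 (hy t (Ioo_subset_Icc_self ht))) (Real.exp_pos _).le
    have h := hmono (left_mem_Icc.2 hT0) (right_mem_Icc.2 hT0) hT0
    simp only [mul_zero, neg_zero, Real.exp_zero, mul_one, hz0] at h
    calc w₀ * Real.exp (ν * T) ≤ z T * Real.exp (-(ν * T)) * Real.exp (ν * T) := by gcongr
      _ = z T := by rw [mul_assoc, ← Real.exp_add]; simp
  apply step t ht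
  by_contra! hcon
  obtain ⟨t₁, ht₁, hlt₁⟩ := hcon
  have hec : Continuous fun t => S * Real.exp (ν * t) := by fun_prop
  let A : Set ℝ := Icc 0 t₁ ∩ {s | z s ≤ S * Real.exp (ν * s)}
  have hAc : IsCompact A := isCompact_Icc.inter_right (isClosed_le hzc hec)
  obtain ⟨s, hsA, hsmin⟩ := hAc.exists_isLeast ⟨t₁, ⟨ht₁.1, le_rfl⟩, hlt₁.le⟩
  have hgt : ∀ r ∈ Ico 0 s, S * Real.exp (ν * r) < z r := by
    intro r hr
    by_contra! h
    exact absurd (hsmin ⟨⟨hr.1, hr.2.le.trans hsA.1.2⟩, h⟩) (not_le.2 hr.2)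
  have hs0 : 0 < s := by
    rcases hsA.1.1.eq_or_lt with h | h
    · have := hsA.2
      simp only [mem_ofPred_eq, ← h, hz0, mul_zero, Real.exp_zero, mul_one] at this
      linarith
    · exact h
  -- At the first contact time `s` the bound from `step`, valid on `[0, s)`, passes to the limit.
  have hge : w₀ * Real.exp (ν * s) ≤ z s := by
    have hmem : s ∈ closure (Ico 0 s) := by
      rw [closure_Ico hs0.ne]; exact ⟨hs0.le, le_rfl⟩
    refine ContinuousWithinAt.closure_le hmem (f := fun r => w₀ * Real.exp (ν * r)) (g := z)
      (Continuous.continuousWithinAt (by fun_prop)) hzc.continuousWithinAt ?_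
    intro r hr
    exact step r hr.1 fun q hq => (hgt q ⟨hq.1, hq.2.trans_lt hr.2⟩).le
  have hle : z s ≤ S * Real.exp (ν * s) := hsA.2
  have := Real.exp_pos (ν * s)
  nlinarith

/-! ### Blow-up by the test function method. -/

/-- Young's inequality in the form used to absorb the linear terms. -/
theorem mul_le_mul_rpow_add {p x L B : ℝ} (hp : 1 < p) (hx : 0 ≤ x) (hL : 0 ≤ L) (hB : 0 < B) :
    x * L ≤ B * x ^ p + B ^ (-(1 / (p - 1))) * L ^ (p / (p - 1)) := by
  have hp1 : 0 < p - 1 := by linarith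
  -- No sharp constant is needed: either `x L` is below the first term, or `x ≤ (L/B)^{1/(p-1)}` and
  -- it is below the second.
  rcases le_total L (B * x ^ (p - 1)) with h | h
  · have h1 : x * L ≤ B * x ^ p := by
      rcases hx.eq_or_lt with rfl | hx0
      · rw [Real.zero_rpow (by linarith)]; simp
      · calc x * L ≤ x * (B * x ^ (p - 1)) := by gcongr
          _ = B * (x ^ (1 : ℝ) * x ^ (p - 1)) := by rw [Real.rpow_one]; ring
          _ = B * x ^ p := by rw [← Real.rpow_add hx0]; congr 2; ring
    have : 0 ≤ B ^ (-(1 / (p - 1))) * L ^ (p / (p - 1)) := by positivity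
    linarith
  · have h0 : x ^ (p - 1) ≤ L / B := by rw [le_div_iff₀ hB]; linarith
    have h1 : x ≤ (L / B) ^ (1 / (p - 1)) := by
      calc x = (x ^ (p - 1)) ^ (1 / (p - 1)) := by
            rw [← Real.rpow_mul hx, mul_one_div_cancel hp1.ne', Real.rpow_one]
        _ ≤ _ := by gcongr
    have h2 : x * L ≤ B ^ (-(1 / (p - 1))) * L ^ (p / (p - 1)) := by
      rcases hL.eq_or_lt with rfl | hL0
      · simp; positivity
      calc x * L ≤ (L / B) ^ (1 / (p - 1)) * L := by gcongr
        _ = B ^ (-(1 / (p - 1))) * (L ^ (1 / (p - 1)) * L ^ (1 : ℝ)) := by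
            rw [Real.div_rpow hL hB.le, Real.rpow_neg hB.le, Real.rpow_one]; ring
        _ = _ := by
            rw [← Real.rpow_add hL0]; congr 2; field_simp; ring
    have : 0 ≤ B * x ^ p := by positivity
    linarith

/-- `(1 + t)^k e^{-νt}` is bounded on `[0, ∞)`. -/
theorem exists_one_add_rpow_mul_exp_le (k : ℝ) {ν : ℝ} (hν : 0 < ν) :
    ∃ C > 0, ∀ t, 0 ≤ t → (1 + t) ^ k * Real.exp (-(ν * t)) ≤ C := by
  have h := (tendsto_rpow_mul_exp_neg_mul_atTop_nhds_zero k ν hν)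
  obtain ⟨R, hR⟩ := eventually_atTop.1 (h.eventually (gt_mem_nhds one_pos))
  have hc : ContinuousOn (fun s : ℝ => s ^ k * Real.exp (-ν * s)) (Icc 1 (max 1 R)) := by
    apply ContinuousOn.mul
    · exact fun s hs => (Real.continuousAt_rpow_const s k
        (Or.inl (by linarith [hs.1]))).continuousWithinAt
    · exact Continuous.continuousOn (by fun_prop)
  obtain ⟨D, hD⟩ := (isCompact_Icc.image_of_continuousOn hc).bddAbove
  refine ⟨max D 1 * Real.exp ν, by positivity, fun t ht => ?_⟩
  have hb : (1 + t) ^ k * Real.exp (-ν * (1 + t)) ≤ max D 1 := by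
    rcases le_total (1 + t) R with h1 | h1
    · exact (hD ⟨1 + t, ⟨by linarith, h1.trans (le_max_right _ _)⟩, rfl⟩).trans (le_max_left _ _)
    · exact (hR _ h1).le.trans (le_max_right _ _)
  calc (1 + t) ^ k * Real.exp (-(ν * t))
      = (1 + t) ^ k * Real.exp (-ν * (1 + t)) * Real.exp ν := by
        rw [mul_assoc, ← Real.exp_add]; congr 2; ring
    _ ≤ _ := by gcongr

/-- The test function `e^{-νt} (1 - t/T)^l`. -/
def cutoffExp (ν T : ℝ) (l : ℕ) (t : ℝ) : ℝ := Real.exp (-(ν * t)) * (1 - t / T) ^ l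

theorem hasDerivAt_cutoffExp (ν T : ℝ) (l : ℕ) (t : ℝ) :
    HasDerivAt (cutoffExp ν T (l + 1))
      (-ν * cutoffExp ν T (l + 1) t - (l + 1) / T * cutoffExp ν T l t) t := by
  have h1 : HasDerivAt (fun t : ℝ => Real.exp (-(ν * t))) (Real.exp (-(ν * t)) * (-(ν * 1))) t :=
    (((hasDerivAt_id t).const_mul ν).neg).exp
  have h2 : HasDerivAt (fun t : ℝ => 1 - t / T) (-(1 / T)) t :=
    ((hasDerivAt_id t).div_const T).const_sub 1
  refine (h1.fun_mul (h2.fun_pow (l + 1))).congr_deriv ?_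
  simp only [cutoffExp, Nat.add_sub_cancel, Nat.cast_add, Nat.cast_one]
  ring

theorem contDiff_cutoffExp (ν T : ℝ) (l : ℕ) {k : WithTop ℕ∞} : ContDiff ℝ k (cutoffExp ν T l) := by
  unfold cutoffExp
  fun_prop

theorem deriv_cutoffExp (ν T : ℝ) (l : ℕ) :
    deriv (cutoffExp ν T (l + 1))
      = fun t => -ν * cutoffExp ν T (l + 1) t - (l + 1) / T * cutoffExp ν T l t :=
  funext fun t => (hasDerivAt_cutoffExp ν T l t).deriv

theorem deriv_deriv_cutoffExp (ν T : ℝ) (l : ℕ) (t : ℝ) :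
    deriv (deriv (cutoffExp ν T (l + 2))) t
      = ν ^ 2 * cutoffExp ν T (l + 2) t + 2 * ν * (l + 2) / T * cutoffExp ν T (l + 1) t
        + (l + 2) * (l + 1) / T ^ 2 * cutoffExp ν T l t := by
  rw [deriv_cutoffExp ν T (l + 1)]
  have h := ((hasDerivAt_cutoffExp ν T (l + 1) t).const_mul (-ν)).sub
    ((hasDerivAt_cutoffExp ν T l t).const_mul (((l + 1 : ℕ) + 1) / T))
  refine (HasDerivAt.deriv (f := fun t => -ν * cutoffExp ν T (l + 1 + 1) t
    - (((l + 1 : ℕ) : ℝ) + 1) / T * cutoffExp ν T (l + 1) t) h).trans ?_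
  push_cast
  ring

/-- Pointwise estimate behind the test function method. -/
theorem cutoffExp_absorb {ν T p B z D t : ℝ} {l : ℕ} (hp : 1 < p) (hν : 0 ≤ ν)
    (hl : ((l : ℝ) + 2) / p ≤ l) (hz : 0 ≤ z) (hB : 0 < B) (ht : t ∈ Icc 0 T) (hT : 0 < T)
    (hD : Real.exp (-(ν * t)) * (B / 2) ^ (-(1 / (p - 1))) ≤ D) :
    B / 2 * z ^ p * cutoffExp ν T (l + 2) t
        - D * ((l + 2) ^ 2 / T ^ 2 + 2 * ν * (l + 2) / T) ^ (p / (p - 1))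
      ≤ (ν ^ 2 * z + B * z ^ p) * cutoffExp ν T (l + 2) t
        - z * deriv (deriv (cutoffExp ν T (l + 2))) t := by
  rw [deriv_deriv_cutoffExp]
  set L : ℝ := (l + 2) ^ 2 / T ^ 2 + 2 * ν * (l + 2) / T with hL
  have hL0 : 0 ≤ L := by positivity
  set x : ℝ := 1 - t / T with hx
  have hx0 : 0 ≤ x := sub_nonneg.2 ((div_le_one hT).2 ht.2)
  have hx1 : x ≤ 1 := sub_le_self _ (div_nonneg ht.1 hT.le)
  have hp0 : 0 < p := by linarith
  have hc : ∀ i : ℕ, cutoffExp ν T i t = Real.exp (-(ν * t)) * x ^ i := fun i => rfl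
  set E := Real.exp (-(ν * t)) with hE
  have hE0 : 0 < E := Real.exp_pos _
  -- The `ν²` term of `η''` cancels the linear term of the inequality; only these two cutoff terms
  -- remain to be absorbed.
  have h1 : 2 * ν * (l + 2) / T * x ^ (l + 1) + (l + 2) * (l + 1) / T ^ 2 * x ^ l ≤ L * x ^ l := by
    have h2 : x ^ (l + 1) ≤ x ^ l := pow_le_pow_of_le_one hx0 hx1 (by omega)
    have h3 : ((l : ℝ) + 2) * (l + 1) / T ^ 2 ≤ (l + 2) ^ 2 / T ^ 2 := by
      gcongr; nlinarith
    calc _ ≤ 2 * ν * (l + 2) / T * x ^ l + (l + 2) ^ 2 / T ^ 2 * x ^ l := by gcongr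
      _ = _ := by rw [hL]; ring
  -- For `l` large, `x^l ≤ (x^{l+2})^{1/p}`, so Young's inequality gives back exactly `z^p x^{l+2}`,
  -- the weight of the nonlinear term.
  have h4 : x ^ l ≤ x ^ (((l : ℝ) + 2) / p) := by
    rw [← Real.rpow_natCast x l]
    exact Real.rpow_le_rpow_of_exponent_ge_of_imp hx0 hx1 hl (by
      intro _ h
      have : ((l : ℝ) + 2) / p > 0 := by positivity
      linarith)
  have h5 := mul_le_mul_rpow_add (x := z * x ^ (((l : ℝ) + 2) / p)) hp (by positivity) hL0
    (half_pos hB)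
  have h6 : (z * x ^ (((l : ℝ) + 2) / p)) ^ p = z ^ p * x ^ (l + 2) := by
    rw [Real.mul_rpow hz (by positivity), ← Real.rpow_mul hx0, div_mul_cancel₀ _ hp0.ne',
      ← Real.rpow_natCast x (l + 2)]
    push_cast; rfl
  rw [h6] at h5
  have h7 : z * (2 * ν * (l + 2) / T * x ^ (l + 1) + (l + 2) * (l + 1) / T ^ 2 * x ^ l)
      ≤ B / 2 * (z ^ p * x ^ (l + 2)) + (B / 2) ^ (-(1 / (p - 1))) * L ^ (p / (p - 1)) := by
    calc _ ≤ z * (L * x ^ (((l : ℝ) + 2) / p)) := by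
          gcongr; exact h1.trans (by gcongr)
      _ = z * x ^ (((l : ℝ) + 2) / p) * L := by ring
      _ ≤ _ := h5
  have h8 : E * (B / 2) ^ (-(1 / (p - 1))) * L ^ (p / (p - 1)) ≤ D * L ^ (p / (p - 1)) := by
    gcongr
  have h9 := mul_le_mul_of_nonneg_left h7 hE0.le
  rw [hc, hc, hc]
  nlinarith [h8, h9]

/-- Integrating against `η = e^{-νt} (1 - t/T)^{l+2}` leaves only the boundary terms `w₀ η'(0) - w₁
η(0) ≤ 0`. The integrand is at least `-R` on `(0, T]` and at least `c₀ - R` on `(0, 1]`, whence `c₀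
≤ T R`. -/
theorem le_of_test_function {G : ℝ → ℝ} (hG : LocallyIntegrable G) {ν p β k w₀ w₁ T D : ℝ} {l : ℕ}
    (hp : 1 < p) (hν : 0 ≤ ν) (hk : 0 ≤ k) (hβ : 0 < β) (hw₀ : 0 < w₀) (hw₁ : ν * w₀ ≤ w₁)
    (hl : ((l : ℝ) + 2) / p ≤ l)
    (hge : ∀ t, 0 ≤ t → w₀ * Real.exp (ν * t) ≤ secondPrimitive G w₀ w₁ t)
    (hineq : ∀ᵐ t, t ∈ Ioi (0 : ℝ) → ν ^ 2 * secondPrimitive G w₀ w₁ t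
      + β * (1 + t) ^ (-k) * secondPrimitive G w₀ w₁ t ^ p ≤ G t)
    (hT : 2 ≤ T)
    (hD : ∀ t ∈ Icc 0 T, Real.exp (-(ν * t)) * (β * (1 + t) ^ (-k) / 2) ^ (-(1 / (p - 1))) ≤ D) :
    β * 2 ^ (-k) / 2 * w₀ ^ p * (Real.exp (-ν) * (1 / 2) ^ (l + 2))
      ≤ T * (D * ((l + 2) ^ 2 / T ^ 2 + 2 * ν * (l + 2) / T) ^ (p / (p - 1))) := by
  set R := D * ((l + 2) ^ 2 / T ^ 2 + 2 * ν * (l + 2) / T) ^ (p / (p - 1)) with hR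
  -- Product of the lower bounds of all factors on `[0, 1]`; `T ≥ 2` gives `1 - t/T ≥ 1/2` there.
  set c₀ := β * 2 ^ (-k) / 2 * w₀ ^ p * (Real.exp (-ν) * (1 / 2) ^ (l + 2)) with hc₀
  set z := secondPrimitive G w₀ w₁ with hz
  set η := cutoffExp ν T (l + 2) with hη
  have hT0 : 0 < T := by linarith
  have hzc : Continuous z := continuous_secondPrimitive hG w₀ w₁
  have hη2 : ContDiff ℝ 2 η := contDiff_cutoffExp ν T (l + 2)
  have hηc : Continuous η := hη2.continuous
  have hηd : Continuous (deriv (deriv η)) :=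
    (ContDiff.deriv' (n := 1) (by rwa [one_add_one_eq_two])).continuous_deriv le_rfl
  have hηT : ∀ i, cutoffExp ν T (i + 1) T = 0 := fun i => by
    simp [cutoffExp, div_self hT0.ne']
  have hi : ∀ a b, IntervalIntegrable (fun t => G t * η t - z t * deriv (deriv η) t) volume a b :=
    fun a b => ((intervalIntegrable_of_locallyIntegrable hG a b).mul_continuousOn
      hηc.continuousOn).sub ((hzc.fun_mul hηd).intervalIntegrable a b)
  have hid := integral_secondPrimitive_mul_deriv_deriv hG w₀ w₁ hη2 T
  have htot : ∫ t in (0 : ℝ)..T, (G t * η t - z t * deriv (deriv η) t) ≤ 0 := by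
    rw [intervalIntegral.integral_sub ((intervalIntegrable_of_locallyIntegrable hG _ _
      ).mul_continuousOn hηc.continuousOn) ((hzc.fun_mul hηd).intervalIntegrable _ _), hz, hid]
    have e1 : deriv η T = 0 := by rw [hη, deriv_cutoffExp ν T (l + 1)]; simp [hηT]
    have e2 : deriv η 0 = -ν - (l + 2) / T := by
      rw [hη, deriv_cutoffExp ν T (l + 1)]; simp [cutoffExp]; ring
    have e3 : η 0 = 1 := by simp [hη, cutoffExp]
    have e4 : η T = 0 := hηT _
    rw [e1, e2, e3, e4]
    have : 0 ≤ w₀ * ((l + 2) / T) := by positivity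
    nlinarith
  have hpt : ∀ᵐ t, t ∈ Ioc 0 T →
      β * (1 + t) ^ (-k) / 2 * z t ^ p * η t - R ≤ G t * η t - z t * deriv (deriv η) t := by
    filter_upwards [hineq] with t ht htm
    have htm' : t ∈ Icc 0 T := Ioc_subset_Icc_self htm
    have hz0 : 0 ≤ z t := le_trans (by positivity) (hge t htm.1.le)
    have hB : 0 < β * (1 + t) ^ (-k) := mul_pos hβ (Real.rpow_pos_of_pos (by linarith [htm.1]) _)
    have h := cutoffExp_absorb hp hν hl hz0 hB htm' hT0 (hD t htm')
    have hη0 : 0 ≤ η t := mul_nonneg (Real.exp_pos _).le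
      (pow_nonneg (sub_nonneg.2 ((div_le_one hT0).2 htm.2)) _)
    have h2 := mul_le_mul_of_nonneg_right (ht htm.1) hη0
    linarith
  have hI1 : c₀ - R ≤ ∫ t in (0 : ℝ)..1, (G t * η t - z t * deriv (deriv η) t) := by
    have : ∫ t in (0 : ℝ)..1, (c₀ - R) = c₀ - R := by simp
    rw [← this]
    apply intervalIntegral.integral_mono_ae_restrict zero_le_one (by simp) (hi _ _)
    rw [EventuallyLE, ae_restrict_iff' measurableSet_Icc]
    filter_upwards [hpt, Measure.ae_ne volume 0] with t ht ht0 htm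
    have htp : 0 < t := lt_of_le_of_ne htm.1 (Ne.symm ht0)
    refine le_trans (sub_le_sub_right ?_ R) (ht ⟨htp, by linarith [htm.2]⟩)
    have a1 : (2 : ℝ) ^ (-k) ≤ (1 + t) ^ (-k) :=
      Real.rpow_le_rpow_of_nonpos (by linarith) (by linarith [htm.2]) (by linarith)
    have a2 : w₀ ≤ z t := by
      refine le_trans ?_ (hge t htp.le)
      exact le_mul_of_one_le_right hw₀.le (Real.one_le_exp (by positivity))
    have a3 : Real.exp (-ν) ≤ Real.exp (-(ν * t)) :=
      Real.exp_le_exp.2 (by nlinarith [htm.2])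
    have a4 : (1 / 2 : ℝ) ≤ 1 - t / T := by
      have : t / T ≤ 1 / 2 := by rw [div_le_div_iff₀ hT0 two_pos]; linarith [htm.2]
      linarith
    have hz0 : 0 ≤ z t := hw₀.le.trans a2
    calc c₀ ≤ β * (1 + t) ^ (-k) / 2 * z t ^ p
          * (Real.exp (-(ν * t)) * (1 - t / T) ^ (l + 2)) := by
          rw [hc₀]; gcongr
      _ = _ := rfl
  have hI2 : (T - 1) * (-R) ≤ ∫ t in (1 : ℝ)..T, (G t * η t - z t * deriv (deriv η) t) := by
    have : ∫ t in (1 : ℝ)..T, (-R) = (T - 1) * (-R) := by simp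
    rw [← this]
    apply intervalIntegral.integral_mono_ae_restrict (by linarith) (by simp) (hi _ _)
    rw [EventuallyLE, ae_restrict_iff' measurableSet_Icc]
    filter_upwards [hpt] with t ht htm
    have htp : 0 < t := by linarith [htm.1]
    refine le_trans ?_ (ht ⟨htp, htm.2⟩)
    have hz0 : 0 ≤ z t := le_trans (by positivity) (hge t htp.le)
    have hη0 : 0 ≤ η t := mul_nonneg (Real.exp_pos _).le
      (pow_nonneg (sub_nonneg.2 ((div_le_one hT0).2 htm.2)) _)
    have : 0 ≤ β * (1 + t) ^ (-k) / 2 * z t ^ p * η t := by positivity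
    linarith
  have hsum := intervalIntegral.integral_add_adjacent_intervals (hi 0 1) (hi 1 T)
  linarith

/-- Blow-up for `w'' ≥ ν² w + β (1 + t)^{-k} w^p`. -/
theorem false_of_secondPrimitive_ineq {G : ℝ → ℝ} (hG : LocallyIntegrable G)
    {ν p β k w₀ w₁ : ℝ} (hp : 1 < p) (hν : 0 ≤ ν) (hk : 0 ≤ k) (hβ : 0 < β) (hw₀ : 0 < w₀)
    (hw₁ : ν * w₀ ≤ w₁)
    (hge : ∀ t, 0 ≤ t → w₀ * Real.exp (ν * t) ≤ secondPrimitive G w₀ w₁ t)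
    (hineq : ∀ᵐ t, t ∈ Ioi (0 : ℝ) → ν ^ 2 * secondPrimitive G w₀ w₁ t
      + β * (1 + t) ^ (-k) * secondPrimitive G w₀ w₁ t ^ p ≤ G t)
    (hνk : 0 < ν ∨ k < p + 1) : False := by
  have hp1 : 0 < p - 1 := by linarith
  have hp0 : 0 < p := by linarith
  obtain ⟨l, hl⟩ := exists_nat_ge (2 / (p - 1))
  have hl' : ((l : ℝ) + 2) / p ≤ l := by
    rw [div_le_iff₀ hp0]
    rw [div_le_iff₀ hp1] at hl
    linarith
  set q := p / (p - 1) with hq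
  have hq0 : 0 < q := by positivity
  have hq1 : 1 < q := by rw [hq, one_lt_div hp1]; linarith
  set c₀ := β * 2 ^ (-k) / 2 * w₀ ^ p * (Real.exp (-ν) * (1 / 2) ^ (l + 2)) with hc₀
  have hc₀pos : 0 < c₀ := by positivity
  have hpow : ∀ t, 0 ≤ t → (β * (1 + t) ^ (-k) / 2) ^ (-(1 / (p - 1)))
      = (β / 2) ^ (-(1 / (p - 1))) * (1 + t) ^ (k / (p - 1)) := by
    intro t ht
    have h1 : 0 ≤ 1 + t := by linarith
    rw [show β * (1 + t) ^ (-k) / 2 = β / 2 * (1 + t) ^ (-k) by ring,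
      Real.mul_rpow (by positivity) (by positivity), ← Real.rpow_mul h1]
    congr 2; field_simp
  -- With `L` the cutoff factor, the bound is `T D L^q`. If `ν > 0`, then `D` is bounded and `L =
  -- O(1/T)`, giving `T^{1-q}`. If `ν = 0`, then `D = O(T^{k/(p-1)})` and `L = O(T^{-2})`; the power
  -- is negative exactly when `k < p + 1`.
  have key : ∃ K s : ℝ, 0 < s ∧ ∀ T, 2 ≤ T → c₀ ≤ K * T ^ (-s) := by
    rcases hν.lt_or_eq with hν0 | rfl
    · obtain ⟨C, hC, hCb⟩ := exists_one_add_rpow_mul_exp_le (k / (p - 1)) hν0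
      refine ⟨(β / 2) ^ (-(1 / (p - 1))) * C * ((l + 2) ^ 2 + 2 * ν * (l + 2)) ^ q, q - 1,
        by linarith, fun T hT => ?_⟩
      have hT0 : 0 < T := by linarith
      refine (le_of_test_function hG hp hν hk hβ hw₀ hw₁ hl' hge hineq hT
        (D := (β / 2) ^ (-(1 / (p - 1))) * C) ?_).trans ?_
      · intro t ht
        rw [hpow t ht.1]
        calc _ = (β / 2) ^ (-(1 / (p - 1)))
              * ((1 + t) ^ (k / (p - 1)) * Real.exp (-(ν * t))) := by ring
          _ ≤ _ := by gcongr; exact hCb t ht.1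
      · have h1 : ((l : ℝ) + 2) ^ 2 / T ^ 2 + 2 * ν * (l + 2) / T
            ≤ ((l + 2) ^ 2 + 2 * ν * (l + 2)) * T⁻¹ := by
          have : ((l : ℝ) + 2) ^ 2 / T ^ 2 ≤ (l + 2) ^ 2 / T := by
            gcongr; nlinarith
          calc _ ≤ ((l : ℝ) + 2) ^ 2 / T + 2 * ν * (l + 2) / T := by gcongr
            _ = _ := by ring
        calc _ ≤ T * ((β / 2) ^ (-(1 / (p - 1))) * C
              * (((l + 2) ^ 2 + 2 * ν * (l + 2)) * T⁻¹) ^ q) := by gcongr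
          _ = (β / 2) ^ (-(1 / (p - 1))) * C * ((l + 2) ^ 2 + 2 * ν * (l + 2)) ^ q
              * (T ^ (1 : ℝ) * T ^ (-q)) := by
              rw [Real.mul_rpow (by positivity) (by positivity), Real.inv_rpow hT0.le,
                Real.rpow_neg hT0.le, Real.rpow_one]
              ring
          _ = _ := by rw [← Real.rpow_add hT0]; congr 2; ring
    · have hk' : k < p + 1 := hνk.resolve_left (lt_irrefl 0)
      refine ⟨(β / 2) ^ (-(1 / (p - 1))) * 2 ^ (k / (p - 1)) * ((l + 2) ^ 2) ^ q,
        2 * q - 1 - k / (p - 1), ?_, fun T hT => ?_⟩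
      · have : 2 * q - 1 - k / (p - 1) = (p + 1 - k) / (p - 1) := by
          rw [hq]; field_simp; ring
        rw [this]
        exact div_pos (by linarith) hp1
      have hT0 : 0 < T := by linarith
      refine (le_of_test_function hG hp le_rfl hk hβ hw₀ hw₁ hl' hge hineq hT
        (D := (β / 2) ^ (-(1 / (p - 1))) * (2 * T) ^ (k / (p - 1))) ?_).trans ?_
      · intro t ht
        have ht0 := ht.1
        rw [hpow t ht.1]
        simp only [zero_mul, neg_zero, Real.exp_zero, one_mul]
        gcongr
        linarith [ht.2]
      · refine le_of_eq ?_
        have h2 : ((l : ℝ) + 2) ^ 2 / T ^ 2 + 2 * 0 * (l + 2) / T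
            = (l + 2) ^ 2 * T ^ (-2 : ℝ) := by
          rw [Real.rpow_neg hT0.le, Real.rpow_two]; ring
        rw [h2, ← hq, Real.mul_rpow two_pos.le hT0.le,
          Real.mul_rpow (x := ((l : ℝ) + 2) ^ 2) (by positivity) (by positivity),
          ← Real.rpow_mul hT0.le]
        calc _ = (β / 2) ^ (-(1 / (p - 1))) * 2 ^ (k / (p - 1)) * ((l + 2) ^ 2) ^ q
              * (T ^ (1 : ℝ) * T ^ (k / (p - 1)) * T ^ (-2 * q)) := by rw [Real.rpow_one]; ring
          _ = _ := by
            rw [← Real.rpow_add hT0, ← Real.rpow_add hT0]; congr 2; ring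
  obtain ⟨K, s, hs, hK⟩ := key
  have hlim : Tendsto (fun T : ℝ => K * T ^ (-s)) atTop (𝓝 0) := by
    simpa using (tendsto_rpow_neg_atTop hs).const_mul K
  have := ge_of_tendsto hlim ((eventually_ge_atTop 2).mono hK)
  linarith

/-- Nonexistence for the averaged problem `w'' = G`, `w(0) = w₀`, `w'(0) = w₁` in the weak sense. -/
theorem false_of_weak_ineq {w G : ℝ → ℝ} {ν p β k S w₀ w₁ : ℝ} (hw : LocallyIntegrable w)
    (hG : LocallyIntegrable G) (hp : 1 < p) (hν : 0 ≤ ν) (hk : 0 ≤ k) (hβ : 0 < β)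
    (hS : 0 ≤ S) (hSw : S < w₀) (hw₁ : ν * w₀ ≤ w₁) (hνk : 0 < ν ∨ k < p + 1)
    (hweak : ∀ φ : ℝ → ℝ, ContDiff ℝ 2 φ → ∀ T > 0, (∀ t ≥ T, φ t = 0) →
      ∫ t in (0 : ℝ)..T, w t * deriv (deriv φ) t
        = (∫ t in (0 : ℝ)..T, G t * φ t) - w₀ * deriv φ 0 + w₁ * φ 0)
    (hineq : ∀ᵐ t, t ∈ Ioi (0 : ℝ) → S * Real.exp (ν * t) ≤ w t →
      ν ^ 2 * w t + β * (1 + t) ^ (-k) * w t ^ p ≤ G t) : False := by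
  have hw₀ : 0 < w₀ := hS.trans_lt hSw
  have hae := ae_eq_secondPrimitive hw hG hweak
  have hineq' : ∀ᵐ t, t ∈ Ioi (0 : ℝ) → S * Real.exp (ν * t) ≤ secondPrimitive G w₀ w₁ t →
      ν ^ 2 * secondPrimitive G w₀ w₁ t
        + β * (1 + t) ^ (-k) * secondPrimitive G w₀ w₁ t ^ p ≤ G t := by
    filter_upwards [hae, hineq] with t h1 h2 ht
    rw [← h1 ht]
    exact h2 ht
  have hge : ∀ t, 0 ≤ t → w₀ * Real.exp (ν * t) ≤ secondPrimitive G w₀ w₁ t := fun t ht =>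
    secondPrimitive_ge_of_threshold hG hν hS hSw hw₁
      (fun t ht => mul_nonneg hβ.le (Real.rpow_nonneg (by linarith) _)) hineq' ht
  refine false_of_secondPrimitive_ineq hG hp hν hk hβ hw₀ hw₁ hge ?_ hνk
  filter_upwards [hineq'] with t h ht
  exact h ht (le_trans (by gcongr) (hge t (le_of_lt ht)))

/-! ### Scale function, curved mass and radius. -/

/-- The rate `κ` in `a = a₀ (1 + κ t)^α`. -/
def scaleRate (n : ℕ) (σ H : ℝ) : ℝ := n * (1 + σ) * H / 2

/-- The exponent `α` in `a = a₀ (1 + κ t)^α`. -/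
def scaleExponent (n : ℕ) (σ H : ℝ) : ℝ := if H = 0 then 0 else 2 / (n * (1 + σ))

/-- Setting the exponent to `0` when `H = 0` brings the constant case, including `σ = -1`, under the
same power law. -/
theorem scale_eq {n : ℕ} {σ H a₀ : ℝ} (h : H = 0 ∨ σ ≠ -1) (t : ℝ) :
    scale n σ H a₀ t = a₀ * (1 + scaleRate n σ H * t) ^ scaleExponent n σ H := by
  have e : 1 + scaleRate n σ H * t = 1 + n * (1 + σ) * H * t / 2 := by
    rw [scaleRate]; ring
  rw [e]
  by_cases hH : H = 0
  · simp [scale, scaleExponent, hH]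
  · simp [scale, scaleExponent, hH, h.resolve_left hH]

theorem scaleExponent_mul_scaleRate {n : ℕ} {σ H : ℝ} (hn : 1 ≤ n) (h : H = 0 ∨ σ ≠ -1) :
    scaleExponent n σ H * scaleRate n σ H = H := by
  rw [scaleExponent, scaleRate]
  split_ifs with hH
  · simp [hH]
  · have h1 : 1 + σ ≠ 0 := fun h' => h.resolve_left hH (by linarith)
    have h2 : (n : ℝ) ≠ 0 := by positivity
    field_simp

theorem hasDerivAt_one_add_mul_rpow (a κ α : ℝ) {t : ℝ} (h : 0 < 1 + κ * t) :
    HasDerivAt (fun t : ℝ => a * (1 + κ * t) ^ α) (a * (α * κ) * (1 + κ * t) ^ (α - 1)) t := by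
  have h1 : HasDerivAt (fun t : ℝ => 1 + κ * t) κ t := by
    simpa using ((hasDerivAt_id t).const_mul κ).const_add 1
  refine ((h1.rpow_const (p := α) (Or.inl h.ne')).const_mul a).congr_deriv ?_
  ring

theorem one_add_mul_pos {κ t : ℝ} (hκ : 0 ≤ κ) (ht : 0 ≤ t) : 0 < 1 + κ * t := by positivity

theorem deriv_scale {n : ℕ} {σ H a₀ : ℝ} (h : H = 0 ∨ σ ≠ -1) (hn : 1 ≤ n) {t : ℝ}
    (ht : 0 < 1 + scaleRate n σ H * t) :
    deriv (scale n σ H a₀) t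
      = a₀ * H * (1 + scaleRate n σ H * t) ^ (scaleExponent n σ H - 1) := by
  rw [funext (scale_eq (a₀ := a₀) h), (hasDerivAt_one_add_mul_rpow _ _ _ ht).deriv,
    scaleExponent_mul_scaleRate hn h]

theorem iteratedDeriv_two_scale {n : ℕ} {σ H a₀ : ℝ} (h : H = 0 ∨ σ ≠ -1) (hn : 1 ≤ n) {t : ℝ}
    (ht : 0 < 1 + scaleRate n σ H * t) :
    iteratedDeriv 2 (scale n σ H a₀) t = a₀ * H * (H - scaleRate n σ H)
        * (1 + scaleRate n σ H * t) ^ (scaleExponent n σ H - 2) := by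
  have hev : deriv (scale n σ H a₀) =ᶠ[𝓝 t] fun t =>
      a₀ * H * (1 + scaleRate n σ H * t) ^ (scaleExponent n σ H - 1) := by
    have hc : ContinuousAt (fun t => 1 + scaleRate n σ H * t) t := by fun_prop
    filter_upwards [hc.eventually (lt_mem_nhds ht)] with s hs
    exact deriv_scale h hn hs
  rw [iteratedDeriv_succ, iteratedDeriv_one, hev.deriv_eq,
    (hasDerivAt_one_add_mul_rpow _ _ _ ht).deriv]
  have h2 := scaleExponent_mul_scaleRate hn h
  rw [sub_mul, one_mul, h2, show scaleExponent n σ H - 1 - 1 = scaleExponent n σ H - 2 by ring]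

theorem scale_pos {n : ℕ} {σ H a₀ : ℝ} (h : H = 0 ∨ σ ≠ -1) (ha₀ : 0 < a₀) {t : ℝ}
    (ht : 0 < 1 + scaleRate n σ H * t) : 0 < scale n σ H a₀ t := by
  rw [scale_eq h]; positivity

theorem sq_eq_ofReal_re_sq {m : ℂ} (hm : m.re = 0) : m ^ 2 = (((m ^ 2).re : ℝ) : ℂ) := by
  apply Complex.ext <;> simp [pow_two, hm]

theorem re_sq_eq_neg_norm_sq {m : ℂ} (hm : m.re = 0) : (m ^ 2).re = -‖m‖ ^ 2 := by
  rw [Complex.sq_norm, Complex.normSq_apply]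
  simp [pow_two, hm]

/-- With `s = 1 + κ t` one has `a'/a = H/s` and `a''/a = H (H - κ)/s²`; inserting `κ = n (1 + σ) H /
2` collapses the curvature terms to `σ (nH/2c)²/s²`. -/
theorem curvedMass_sq {n : ℕ} {c σ H a₀ : ℝ} {m : ℂ} (h : H = 0 ∨ σ ≠ -1) (hn : 1 ≤ n)
    (hc : 0 < c) (ha₀ : 0 < a₀) (hm : m.re = 0) {t : ℝ} (ht : 0 < 1 + scaleRate n σ H * t) :
    curvedMass n c m (scale n σ H a₀) t ^ 2
      = (((m ^ 2).re + σ * (n * H / (2 * c)) ^ 2 / (1 + scaleRate n σ H * t) ^ 2 : ℝ) : ℂ) := by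
  have h1 : curvedMass n c m (scale n σ H a₀) t ^ 2 = curvedMassSq n c m (scale n σ H a₀) t := by
    rw [curvedMass, ← Complex.cpow_nat_mul]
    norm_num
  rw [h1, curvedMassSq, sq_eq_ofReal_re_sq hm, deriv_scale h hn ht,
    iteratedDeriv_two_scale h hn ht, scale_eq h, Real.rpow_sub ht, Real.rpow_sub ht, Real.rpow_one,
    Real.rpow_two, ← Complex.ofReal_sub, ← Complex.ofReal_sub, Complex.ofReal_inj,
    Complex.ofReal_re]
  have hs : 0 < (1 + scaleRate n σ H * t) ^ scaleExponent n σ H := Real.rpow_pos_of_pos ht _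
  generalize (1 + scaleRate n σ H * t) ^ scaleExponent n σ H = A at hs ⊢
  set s := 1 + scaleRate n σ H * t with hsdef
  have e1 : a₀ * H * (A / s) / (a₀ * A) = H / s := by field_simp
  have e2 : a₀ * H * (H - scaleRate n σ H) * (A / s ^ 2) / (a₀ * A)
      = H * (H - scaleRate n σ H) / s ^ 2 := by field_simp
  rw [e1, e2, scaleRate]
  field_simp
  ring

theorem continuousOn_scale {n : ℕ} {σ H a₀ : ℝ} (h : H = 0 ∨ σ ≠ -1)
    (hκ : 0 ≤ scaleRate n σ H) : ContinuousOn (scale n σ H a₀) (Ici 0) := by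
  rw [funext (scale_eq (a₀ := a₀) h)]
  exact fun t ht => (hasDerivAt_one_add_mul_rpow _ _ _
    (one_add_mul_pos hκ ht)).continuousAt.continuousWithinAt

theorem intervalIntegrable_div_scale {n : ℕ} {c σ H a₀ : ℝ} (h : H = 0 ∨ σ ≠ -1)
    (hκ : 0 ≤ scaleRate n σ H) (ha₀ : 0 < a₀) {s t : ℝ} (hs : 0 ≤ s) (ht : 0 ≤ t) :
    IntervalIntegrable (fun s => c / scale n σ H a₀ s) volume s t := by
  have hsub : uIcc s t ⊆ Ici 0 := fun x hx => (le_min hs ht).trans hx.1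
  exact (continuousOn_const.div ((continuousOn_scale h hκ).mono hsub) fun x hx =>
    (scale_pos h ha₀ (one_add_mul_pos hκ (hsub hx))).ne').intervalIntegrable

theorem radius_mono {n : ℕ} {c r₀ σ H a₀ : ℝ} (h : H = 0 ∨ σ ≠ -1) (hc : 0 < c)
    (hκ : 0 ≤ scaleRate n σ H) (ha₀ : 0 < a₀) {s t : ℝ} (hs : 0 ≤ s) (hst : s ≤ t) :
    radius c r₀ (scale n σ H a₀) s ≤ radius c r₀ (scale n σ H a₀) t := by
  have ht := hs.trans hst
  have h1 := intervalIntegral.integral_add_adjacent_intervals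
    (intervalIntegrable_div_scale (c := c) h hκ ha₀ le_rfl hs)
    (intervalIntegrable_div_scale (c := c) h hκ ha₀ hs ht)
  have h2 : 0 ≤ ∫ x in s..t, c / scale n σ H a₀ x :=
    intervalIntegral.integral_nonneg hst fun x hx =>
      (div_pos hc (scale_pos h ha₀ (one_add_mul_pos hκ (hs.trans hx.1)))).le
  rw [radius, radius]
  linarith

theorem le_radius {n : ℕ} {c r₀ σ H a₀ : ℝ} (h : H = 0 ∨ σ ≠ -1) (hc : 0 < c)
    (hκ : 0 ≤ scaleRate n σ H) (ha₀ : 0 < a₀) {t : ℝ} (ht : 0 ≤ t) :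
    r₀ ≤ radius c r₀ (scale n σ H a₀) t := by
  have := radius_mono (r₀ := r₀) h hc hκ ha₀ le_rfl ht
  simpa [radius] using this

theorem radius_le_of_static {n : ℕ} {c r₀ σ a₀ : ℝ} (hc : 0 < c) (ha₀ : 0 < a₀) (hr₀ : 0 < r₀)
    {t : ℝ} (ht : 0 ≤ t) : radius c r₀ (scale n σ 0 a₀) t ≤ (r₀ + c / a₀) * (1 + t) := by
  have : ∀ s, scale n σ 0 a₀ s = a₀ := fun s => by simp [scale]
  simp only [radius, this, intervalIntegral.integral_const, smul_eq_mul, sub_zero]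
  have : 0 < c / a₀ := by positivity
  nlinarith

/-- The integrand `c/a`, of order `s^{-α}`, is dominated by `s^{γ-1}`. Leaving `γ > 0` free instead
of fixing `1 - α` also covers `α ≥ 1`, including the logarithm at `α = 1`. -/
theorem radius_le_rpow {n : ℕ} {c r₀ σ H a₀ γ : ℝ} (h : H = 0 ∨ σ ≠ -1) (hc : 0 < c)
    (hκ : 0 < scaleRate n σ H) (ha₀ : 0 < a₀) (hr₀ : 0 < r₀) (hγ : 0 < γ)
    (hγα : 1 - scaleExponent n σ H ≤ γ) {t : ℝ} (ht : 0 ≤ t) :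
    radius c r₀ (scale n σ H a₀) t
      ≤ (r₀ + c / (a₀ * (scaleRate n σ H * γ))) * (1 + scaleRate n σ H * t) ^ γ := by
  set κ := scaleRate n σ H with hκdef
  set α := scaleExponent n σ H with hα
  have hd : ∀ x ∈ uIcc 0 t, HasDerivAt (fun s : ℝ => c / (a₀ * (κ * γ)) * (1 + κ * s) ^ γ)
      (c / (a₀ * (κ * γ)) * (γ * κ) * (1 + κ * x) ^ (γ - 1)) x := by
    intro x hx
    rw [uIcc_of_le ht] at hx
    exact hasDerivAt_one_add_mul_rpow _ _ _ (one_add_mul_pos hκ.le hx.1)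
  have hcont : ContinuousOn (fun x => c / (a₀ * (κ * γ)) * (γ * κ) * (1 + κ * x) ^ (γ - 1))
      (uIcc 0 t) := by
    rw [uIcc_of_le ht]
    exact fun x hx => (hasDerivAt_one_add_mul_rpow _ _ _
      (one_add_mul_pos hκ.le hx.1)).continuousAt.continuousWithinAt
  have hint := intervalIntegral.integral_eq_sub_of_hasDerivAt hd hcont.intervalIntegrable
  have hle : ∫ x in (0 : ℝ)..t, c / scale n σ H a₀ x
      ≤ ∫ x in (0 : ℝ)..t, c / (a₀ * (κ * γ)) * (γ * κ) * (1 + κ * x) ^ (γ - 1) := by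
    apply intervalIntegral.integral_mono_on ht
      (intervalIntegrable_div_scale h hκ.le ha₀ le_rfl ht) hcont.intervalIntegrable
    intro x hx
    have hs := one_add_mul_pos hκ.le hx.1
    have hs1 : 1 ≤ 1 + κ * x := le_add_of_nonneg_right (mul_nonneg hκ.le hx.1)
    rw [scale_eq h, ← hκdef, ← hα]
    have e1 : c / (a₀ * (1 + κ * x) ^ α) = c / a₀ * (1 + κ * x) ^ (-α) := by
      rw [Real.rpow_neg hs.le]; field_simp
    have e2 : c / (a₀ * (κ * γ)) * (γ * κ) = c / a₀ := by field_simp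
    rw [e1, e2]
    gcongr
    linarith
  rw [hint] at hle
  have h1 : 1 ≤ (1 + κ * t) ^ γ :=
    Real.one_le_rpow (le_add_of_nonneg_right (mul_nonneg hκ.le ht)) hγ.le
  have h2 : 0 < c / (a₀ * (κ * γ)) := by positivity
  rw [radius]
  simp only [mul_zero, add_zero, Real.one_rpow, mul_one] at hle
  nlinarith

theorem exists_scale_mul_radius_sq_le {n : ℕ} {c r₀ σ H a₀ γ : ℝ} (h : H = 0 ∨ σ ≠ -1)
    (hc : 0 < c) (hκ : 0 < scaleRate n σ H) (ha₀ : 0 < a₀) (hr₀ : 0 < r₀) (hγ : 0 < γ)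
    (hγα : 1 - scaleExponent n σ H ≤ γ) :
    ∃ C > 0, ∀ t, 0 ≤ t → scale n σ H a₀ t * radius c r₀ (scale n σ H a₀) t ^ 2
      ≤ C * (1 + t) ^ (scaleExponent n σ H + 2 * γ) := by
  set κ := scaleRate n σ H with hκdef
  set α := scaleExponent n σ H with hα
  set D := r₀ + c / (a₀ * (κ * γ)) with hD
  have hD0 : 0 < D := by positivity
  -- The constant comes from `1 + κ t ≤ (1 + κ)(1 + t)`, raised to the power `α + 2γ ≥ 0`.
  refine ⟨a₀ * D ^ 2 * (1 + κ) ^ (α + 2 * γ), by positivity, fun t ht => ?_⟩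
  have hs := one_add_mul_pos hκ.le ht
  have hr0 : 0 ≤ radius c r₀ (scale n σ H a₀) t := hr₀.le.trans (le_radius h hc hκ.le ha₀ ht)
  calc scale n σ H a₀ t * radius c r₀ (scale n σ H a₀) t ^ 2
      ≤ a₀ * (1 + κ * t) ^ α * (D * (1 + κ * t) ^ γ) ^ 2 := by
        rw [scale_eq h]
        gcongr
        exact radius_le_rpow h hc hκ ha₀ hr₀ hγ hγα ht
    _ = a₀ * D ^ 2 * (1 + κ * t) ^ (α + 2 * γ) := by
        rw [Real.rpow_add hs, mul_comm 2 γ, Real.rpow_mul hs.le, Real.rpow_two]; ring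
    _ ≤ a₀ * D ^ 2 * ((1 + κ) * (1 + t)) ^ (α + 2 * γ) := by
        gcongr
        · linarith
        · nlinarith
    _ = _ := by rw [Real.mul_rpow (by positivity) (by positivity)]; ring

/-! ### Lower bounds for the coefficient `b`. -/

theorem unitBallVolume_pos (n : ℕ) : 0 < unitBallVolume n :=
  ENNReal.toReal_pos (Metric.measure_ball_pos _ _ one_pos).ne' measure_ball_lt_top.ne

theorem coeffB_pos {n : ℕ} {c lam p r₀ t : ℝ} {a : ℝ → ℝ} (hlam : 0 < lam) (ha : 0 < a t)
    (hr : 0 < radius c r₀ a t) : 0 < coeffB n c lam p r₀ a t := by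
  have := unitBallVolume_pos n
  unfold coeffB; positivity

theorem coeffB_ge {n : ℕ} {c lam p r₀ C k t : ℝ} {a : ℝ → ℝ} (hlam : 0 < lam) (hp : 1 < p)
    (ha : 0 < a t) (hr : 0 < radius c r₀ a t) (hC : 0 < C) (ht : 0 ≤ t)
    (hle : a t * radius c r₀ a t ^ 2 ≤ C * (1 + t) ^ k) :
    lam / (unitBallVolume n ^ (p - 1) * C ^ (n * (p - 1) / 2))
      * (1 + t) ^ (-(k * (n * (p - 1) / 2))) ≤ coeffB n c lam p r₀ a t := by
  have hω := unitBallVolume_pos n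
  have hp1 : 0 < p - 1 := by linarith
  have ht1 : 0 < 1 + t := by linarith
  calc _ = lam / (unitBallVolume n ^ (p - 1) * (C * (1 + t) ^ k) ^ (n * (p - 1) / 2)) := by
        rw [Real.mul_rpow hC.le (by positivity), ← Real.rpow_mul ht1.le, Real.rpow_neg ht1.le]
        field_simp
    _ ≤ _ := by unfold coeffB; gcongr

/-! ### Spatial averages of a weak solution. -/

/-- Up to time `T` the function is carried by the compact cylinder of radius `r T`, where local
integrability is integrability. -/
theorem integrable_of_finiteSpeed {n : ℕ} {f : ℝ × Space n → ℂ} {r : ℝ → ℝ} {T : ℝ}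
    (hf : LocallyIntegrableOn f (halfSpace n))
    (hr : ∀ t ∈ Icc 0 T, r t ≤ r T)
    (hfs : ∀ᵐ z ∂(volume.restrict (halfSpace n)), r z.1 < ‖z.2‖ → f z = 0) :
    Integrable f ((volume.restrict (Icc 0 T)).prod volume) := by
  have hsub : Icc (0 : ℝ) T ×ˢ (univ : Set (Space n)) ⊆ halfSpace n :=
    prod_mono Icc_subset_Ici_self Subset.rfl
  have hK : IntegrableOn f (Icc 0 T ×ˢ Metric.closedBall 0 (r T)) :=
    hf.integrableOn_compact_subset
      (prod_mono Icc_subset_Ici_self (subset_univ _))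
      (isCompact_Icc.prod (isCompact_closedBall _ _))
  have h1 : IntegrableOn f (Icc (0 : ℝ) T ×ˢ (univ : Set (Space n))) := by
    refine hK.of_ae_sdiff_eq_zero (measurableSet_Icc.prod MeasurableSet.univ).nullMeasurableSet ?_
    have h2 := (ae_restrict_iff' (measurableSet_Ici.prod MeasurableSet.univ)).1 hfs
    filter_upwards [h2] with z hz hzm
    refine hz (hsub hzm.1) ((hr z.1 hzm.1.1).trans_lt ?_)
    by_contra! h
    exact hzm.2 ⟨hzm.1.1, by simpa using h⟩
  have e : (volume.restrict (Icc (0 : ℝ) T)).prod (volume : Measure (Space n))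
      = volume.restrict (Icc (0 : ℝ) T ×ˢ (univ : Set (Space n))) := by
    conv_lhs => rw [← Measure.restrict_univ (μ := (volume : Measure (Space n)))]
    rw [Measure.prod_restrict, ← Measure.volume_eq_prod]
  rw [e]
  exact h1

theorem ae_slice_of_ae_halfSpace {n : ℕ} {P : ℝ × Space n → Prop}
    (h : ∀ᵐ z ∂(volume.restrict (halfSpace n)), P z) :
    ∀ᵐ t, t ∈ Ici (0 : ℝ) → ∀ᵐ x, P (t, x) := by
  rw [halfSpace, Measure.volume_eq_prod, ← Measure.prod_restrict, Measure.restrict_univ] at h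
  exact (ae_restrict_iff' measurableSet_Ici).1 (Measure.ae_ae_of_ae_prod h)

theorem locallyIntegrable_indicator_Ici {f : ℝ → ℝ} (hf : ∀ T, IntegrableOn f (Icc 0 T)) :
    LocallyIntegrable ((Ici 0).indicator f) := by
  intro x
  refine ⟨Icc (x - 1) (x + 1), Icc_mem_nhds (by linarith) (by linarith), ?_⟩
  rw [IntegrableOn, integrable_indicator_iff measurableSet_Ici, IntegrableOn,
    Measure.restrict_restrict measurableSet_Ici]
  exact (hf (x + 1)).mono_set fun y hy => ⟨hy.1, hy.2.2⟩

theorem setIntegral_Ioi_eq_intervalIntegral {E : Type*} [NormedAddCommGroup E] [NormedSpace ℝ E]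
    {f : ℝ → E} {T : ℝ} (hT : 0 ≤ T) (hf : ∀ t > T, f t = 0) :
    ∫ t in Ioi (0 : ℝ), f t = ∫ t in (0 : ℝ)..T, f t := by
  rw [intervalIntegral.integral_of_le hT]
  refine (setIntegral_eq_of_subset_of_forall_sdiff_eq_zero measurableSet_Ioi
    Ioc_subset_Ioi_self fun t ht => hf t ?_)
  by_contra! h
  exact ht.2 ⟨ht.1, h⟩

theorem deriv_deriv_eq_zero_of_forall_ge {φ : ℝ → ℝ} {T : ℝ} (hφ : ∀ t ≥ T, φ t = 0) {t : ℝ}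
    (ht : T < t) : deriv (deriv φ) t = 0 := by
  have h : φ =ᶠ[𝓝 t] fun _ => 0 := by
    filter_upwards [lt_mem_nhds ht] with s hs using hφ s hs.le
  rw [h.deriv.deriv_eq]; simp

/-- The norm of an integral over a ball is controlled by the integral of a power. -/
theorem norm_integral_rpow_le {n : ℕ} {f : Space n → ℂ} {p r : ℝ} (hp : 1 < p) (hr : 0 < r)
    (hfm : AEStronglyMeasurable f) (hfp : Integrable fun x => ‖f x‖ ^ p)
    (hsupp : ∀ᵐ x, r < ‖x‖ → f x = 0) :
    ‖∫ x, f x‖ ^ p ≤ (unitBallVolume n * r ^ n) ^ (p - 1) * ∫ x, ‖f x‖ ^ p := by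
  have hp0 : 0 < p := by linarith
  have hp1 : 0 < p - 1 := by linarith
  have hpq : p.HolderConjugate (p / (p - 1)) := Real.HolderConjugate.conjExponent hp
  -- Hölder's inequality against the indicator of the ball produces the volume `ω_n r^n`.
  let χ : Space n → ℝ := (Metric.closedBall (0 : Space n) r).indicator fun _ => 1
  have hball : volume (Metric.closedBall (0 : Space n) r) ≠ ⊤ := measure_closedBall_lt_top.ne
  have hVol : (volume : Measure (Space n)).real (Metric.closedBall 0 r)
      = unitBallVolume n * r ^ n := by
    rw [Measure.addHaar_real_closedBall _ _ hr.le, finrank_euclideanSpace_fin, mul_comm]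
    rfl
  have h1 : ∫ x, ‖f x‖ * χ x = ∫ x, ‖f x‖ := by
    apply integral_congr_ae
    filter_upwards [hsupp] with x hx
    by_cases h : ‖x‖ ≤ r
    · simp [χ, h]
    · simp [hx (not_le.1 h)]
  have hfL : MemLp (fun x => ‖f x‖) (ENNReal.ofReal p) := by
    rw [memLp_norm_iff hfm]
    rw [← integrable_norm_rpow_iff hfm (by simpa using hp0) (by simp)]
    simpa [ENNReal.toReal_ofReal hp0.le] using hfp
  have hχL : MemLp χ (ENNReal.ofReal (p / (p - 1))) :=
    memLp_indicator_const _ Metric.isClosed_closedBall.measurableSet 1 (Or.inr hball)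
  have h2 := integral_mul_le_Lp_mul_Lq_of_nonneg hpq (μ := volume) (f := fun x => ‖f x‖) (g := χ)
    (Eventually.of_forall fun x => norm_nonneg _)
    (Eventually.of_forall fun x => indicator_nonneg (fun _ _ => zero_le_one) x) hfL hχL
  have h3 : ∫ x, χ x ^ (p / (p - 1)) = unitBallVolume n * r ^ n := by
    have : (fun x => χ x ^ (p / (p - 1))) = χ := by
      funext x
      by_cases h : x ∈ Metric.closedBall (0 : Space n) r
      · simp [χ, indicator_of_mem h]
      · simp only [χ, indicator_of_notMem h]
        exact Real.zero_rpow (div_pos hp0 hp1).ne'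
    rw [this, integral_indicator_const _ Metric.isClosed_closedBall.measurableSet, hVol]
    simp
  rw [h1, h3] at h2
  have hV : 0 ≤ unitBallVolume n * r ^ n := mul_nonneg (unitBallVolume_pos n).le (by positivity)
  have hI : 0 ≤ ∫ x, ‖f x‖ ^ p := integral_nonneg fun x => by positivity
  calc ‖∫ x, f x‖ ^ p ≤ (∫ x, ‖f x‖) ^ p := by
        gcongr; exact norm_integral_le_integral_norm _
    _ ≤ ((∫ x, ‖f x‖ ^ p) ^ (1 / p)
          * (unitBallVolume n * r ^ n) ^ (1 / (p / (p - 1)))) ^ p := by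
        gcongr
    _ = _ := by
        rw [Real.mul_rpow (by positivity) (by positivity), ← Real.rpow_mul hI,
          ← Real.rpow_mul hV, one_div_mul_cancel hp0.ne', Real.rpow_one, mul_comm,
          one_div_div, div_mul_cancel₀ _ hp0.ne']

/-- Testing with functions that are constant in space on the support of the solution. -/
theorem averaged_weak_eq {n : ℕ} {c T : ℝ} {a r μ : ℝ → ℝ} {M : ℝ → ℂ} {h u : ℝ × Space n → ℂ}
    {u₀ u₁ : Space n → ℂ} (hsol : IsWeakGlobalSolution n c a M h u₀ u₁ u) (hT : 0 < T)
    (hr0 : 0 ≤ r 0) (hr : ∀ t ∈ Icc 0 T, r t ≤ r T)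
    (hu : ∀ᵐ z ∂(volume.restrict (halfSpace n)), r z.1 < ‖z.2‖ → u z = 0)
    (hh : ∀ᵐ z ∂(volume.restrict (halfSpace n)), r z.1 < ‖z.2‖ → h z = 0)
    (hsupp₀ : ∀ᵐ x, r 0 < ‖x‖ → u₀ x = 0) (hsupp₁ : ∀ᵐ x, r 0 < ‖x‖ → u₁ x = 0)
    (hM : ∀ t, 0 ≤ t → M t ^ 2 = (μ t : ℂ)) (hμ : ContinuousOn μ (Ici 0))
    {φ : ℝ → ℝ} (hφ : ContDiff ℝ 2 φ) (hφT : ∀ t ≥ T, φ t = 0) :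
    (c ^ 2)⁻¹ * ((∫ x, u₀ x).re * deriv φ 0) - (c ^ 2)⁻¹ * ((∫ x, u₁ x).re * φ 0)
      + (∫ t in (0 : ℝ)..T, (∫ x, u (t, x)).re * ((c ^ 2)⁻¹ * deriv (deriv φ) t + μ t * φ t))
      + ∫ t in (0 : ℝ)..T, (∫ x, h (t, x)).re * φ t = 0 := by
  have hrT : 0 ≤ r T := hr0.trans (hr 0 ⟨le_rfl, hT.le⟩)
  -- `κ` cuts `φ` off at negative times and `χ` cuts off in space. The unit margins make both equal
  -- to `1` on a neighbourhood of the region that matters, so time derivatives are unchanged and the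
  -- Laplacian vanishes there.
  let κ : ContDiffBump (0 : ℝ) := ⟨T + 1, T + 2, by linarith, by linarith⟩
  let χ : ContDiffBump (0 : Space n) := ⟨r T + 1, r T + 2, by linarith, by linarith⟩
  let ρ : ℝ → ℝ := fun t => κ t * φ t
  have hρ2 : ContDiff ℝ 2 ρ := κ.contDiff.mul hφ
  have hκ1 : ∀ t, |t| < T + 1 → κ t = 1 := fun t ht =>
    κ.one_of_mem_closedBall (by simpa using ht.le)
  have hρev : ∀ t, |t| < T + 1 → ρ =ᶠ[𝓝 t] φ := by
    intro t ht
    filter_upwards [(continuous_abs.tendsto t).eventually (gt_mem_nhds ht)] with s hs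
    simp only [ρ, hκ1 s hs, one_mul]
  have hρT : ∀ t ≥ T, ρ t = 0 := fun t ht => by simp [ρ, hφT t ht]
  have hρ : ∀ t, 0 ≤ t → ρ t = φ t := by
    intro t ht
    rcases lt_or_ge t (T + 1) with h1 | h1
    · exact (hρev t (by rwa [abs_of_nonneg ht])).self_of_nhds
    · rw [hρT t (by linarith), hφT t (by linarith)]
  have hρ'' : ∀ t, 0 ≤ t → deriv (deriv ρ) t = deriv (deriv φ) t := by
    intro t ht
    rcases lt_or_ge t (T + 1) with h1 | h1
    · exact (hρev t (by rwa [abs_of_nonneg ht])).deriv.deriv_eq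
    · rw [deriv_deriv_eq_zero_of_forall_ge hρT (by linarith),
        deriv_deriv_eq_zero_of_forall_ge hφT (by linarith)]
  have hρ' : deriv ρ 0 = deriv φ 0 := (hρev 0 (by rw [abs_zero]; linarith)).deriv_eq
  let ψ : ℝ × Space n → ℝ := fun z => ρ z.1 * χ z.2
  have hψ2 : ContDiff ℝ 2 ψ :=
    (hρ2.comp contDiff_fst).mul (χ.contDiff.comp contDiff_snd)
  have hψc : HasCompactSupport ψ := by
    refine HasCompactSupport.intro ((isCompact_closedBall (0 : ℝ) (T + 2)).prod
      (isCompact_closedBall (0 : Space n) (r T + 2))) fun z hz => ?_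
    by_cases h1 : z.1 ∈ Metric.closedBall (0 : ℝ) (T + 2)
    · have h2 : z.2 ∉ Metric.closedBall (0 : Space n) (r T + 2) := fun h2 => hz ⟨h1, h2⟩
      have : χ z.2 = 0 := χ.zero_of_le_dist (not_le.1 h2).le
      simp [ψ, this]
    · have : κ z.1 = 0 := κ.zero_of_le_dist (not_le.1 h1).le
      simp [ψ, ρ, this]
  have hχ1 : ∀ x : Space n, ‖x‖ ≤ r T → χ x = 1 := fun x hx =>
    χ.one_of_mem_closedBall (by simpa using hx.trans (by linarith))
  have hΔ : ∀ t, ∀ x : Space n, ‖x‖ ≤ r T → (Δ (fun y => ρ t * χ y)) x = 0 := by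
    intro t x hx
    have hev : (fun y => ρ t * χ y) =ᶠ[𝓝 x] fun _ => ρ t := by
      filter_upwards [(continuous_norm.tendsto x).eventually
        (gt_mem_nhds (lt_of_le_of_lt hx (lt_add_one (r T))))] with y hy
      rw [χ.one_of_mem_closedBall (by simpa using hy.le), mul_one]
    rw [(InnerProductSpace.laplacian_congr_nhds hev).self_of_nhds]
    simp
  have hweak := hsol.weak_eq ψ hψ2 hψc
  have hinit : ∀ (v : Space n → ℂ) (d : ℝ), (∀ᵐ x, r 0 < ‖x‖ → v x = 0) →
      ∫ x, v x * ((d * χ x : ℝ) : ℂ) = (∫ x, v x) * (d : ℂ) := by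
    intro v d hv
    rw [← integral_mul_const]
    apply integral_congr_ae
    filter_upwards [hv] with x hx
    by_cases h1 : ‖x‖ ≤ r 0
    · rw [hχ1 x (h1.trans (hr 0 ⟨le_rfl, hT.le⟩)), mul_one]
    · rw [hx (not_le.1 h1)]; simp
  have e1 : ∫ x, u₀ x * (deriv (fun s => ψ (s, x)) 0 : ℝ) = (∫ x, u₀ x) * (deriv φ 0 : ℝ) := by
    rw [← hρ', ← hinit u₀ _ hsupp₀]
    refine integral_congr_ae (Eventually.of_forall fun x => ?_)
    simp only [ψ, deriv_mul_const_field]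
  have e2 : ∫ x, u₁ x * (ψ (0, x) : ℝ) = (∫ x, u₁ x) * (φ 0 : ℝ) := by
    rw [← hρ 0 le_rfl, ← hinit u₁ _ hsupp₁]
  have hslice : ∀ᵐ t, t ∈ Ici (0 : ℝ) → ∀ᵐ x, r t < ‖x‖ → u (t, x) = 0 :=
    ae_slice_of_ae_halfSpace hu
  have hslice' : ∀ᵐ t, t ∈ Ici (0 : ℝ) → ∀ᵐ x, r t < ‖x‖ → h (t, x) = 0 :=
    ae_slice_of_ae_halfSpace hh
  have e3 : ∫ t in Ioi (0 : ℝ), ∫ x, u (t, x) *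
      (((c ^ 2)⁻¹ : ℂ) * (iteratedDeriv 2 (fun s => ψ (s, x)) t : ℝ)
        - ((a t ^ 2)⁻¹ : ℂ) * ((Δ (fun y => ψ (t, y))) x : ℝ) + M t ^ 2 * (ψ (t, x) : ℝ))
      = ∫ t in (0 : ℝ)..T,
        (∫ x, u (t, x)) * (((c ^ 2)⁻¹ * deriv (deriv φ) t + μ t * φ t : ℝ) : ℂ) := by
    rw [← setIntegral_Ioi_eq_intervalIntegral hT.le]
    · apply setIntegral_congr_ae measurableSet_Ioi
      filter_upwards [hslice] with t ht ht0
      have ht0' : 0 ≤ t := le_of_lt ht0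
      rw [← integral_mul_const]
      apply integral_congr_ae
      have hit : ∀ x, iteratedDeriv 2 (fun s => ψ (s, x)) t = deriv (deriv φ) t * χ x := by
        intro x
        rw [iteratedDeriv_succ, iteratedDeriv_one, ← hρ'' t ht0']
        have : deriv (fun s => ψ (s, x)) = fun s => deriv ρ s * χ x :=
          funext fun s => by simp only [ψ, deriv_mul_const_field]
        rw [this, deriv_mul_const_field]
      rcases le_or_gt t T with htT | htT
      · filter_upwards [ht ht0'] with x hx
        by_cases h1 : ‖x‖ ≤ r t
        · have h2 : ‖x‖ ≤ r T := h1.trans (hr t ⟨ht0', htT⟩)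
          have h3 : (Δ (fun y => ψ (t, y))) x = 0 := hΔ t x h2
          rw [hit, h3, hM t ht0']
          simp only [ψ, hχ1 x h2, hρ t ht0']
          push_cast
          ring
        · rw [hx (not_le.1 h1)]; simp
      · refine Eventually.of_forall fun x => ?_
        simp only [hit, deriv_deriv_eq_zero_of_forall_ge hφT htT, hφT t htT.le, ψ, hρT t htT.le]
        simp
    · intro t ht
      simp [deriv_deriv_eq_zero_of_forall_ge hφT ht, hφT t (le_of_lt ht)]
  have e4 : ∫ t in Ioi (0 : ℝ), ∫ x, h (t, x) * (ψ (t, x) : ℝ)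
      = ∫ t in (0 : ℝ)..T, (∫ x, h (t, x)) * ((φ t : ℝ) : ℂ) := by
    rw [← setIntegral_Ioi_eq_intervalIntegral hT.le]
    · apply setIntegral_congr_ae measurableSet_Ioi
      filter_upwards [hslice'] with t ht ht0
      have ht0' : 0 ≤ t := le_of_lt ht0
      rw [← integral_mul_const]
      apply integral_congr_ae
      rcases le_or_gt t T with htT | htT
      · filter_upwards [ht ht0'] with x hx
        by_cases h1 : ‖x‖ ≤ r t
        · simp only [ψ, hχ1 x (h1.trans (hr t ⟨ht0', htT⟩)), hρ t ht0', mul_one]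
        · rw [hx (not_le.1 h1)]; simp
      · refine Eventually.of_forall fun x => ?_
        simp [ψ, hρT t htT.le, hφT t htT.le]
    · intro t ht
      simp [hφT t (le_of_lt ht)]
  rw [e1, e2, e3, e4] at hweak
  have hre : ∀ (f : ℝ × Space n → ℂ) (q : ℝ → ℝ), LocallyIntegrableOn f (halfSpace n) →
      (∀ᵐ z ∂(volume.restrict (halfSpace n)), r z.1 < ‖z.2‖ → f z = 0) →
      ContinuousOn q (Icc 0 T) →
      (∫ t in (0 : ℝ)..T, (∫ x, f (t, x)) * (q t : ℂ)).re
        = ∫ t in (0 : ℝ)..T, (∫ x, f (t, x)).re * q t := by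
    intro f q hf hf0 hq
    have hI := (integrable_of_finiteSpeed hf hr hf0).integral_prod_left
    have hqc : ContinuousOn (fun t => (q t : ℂ)) (Icc 0 T) :=
      Complex.continuous_ofReal.comp_continuousOn hq
    have hI2 : IntegrableOn (fun t => (∫ x, f (t, x)) * (q t : ℂ)) (Icc 0 T) :=
      IntegrableOn.mul_continuousOn hI hqc isCompact_Icc
    rw [intervalIntegral.integral_of_le hT.le, intervalIntegral.integral_of_le hT.le]
    have h5 := integral_re (𝕜 := ℂ) (hI2.mono_set Ioc_subset_Icc_self)
    rw [← RCLike.re_eq_complex_re, ← h5]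
    refine integral_congr_ae (Eventually.of_forall fun t => ?_)
    simp
  have hφ'' : Continuous (deriv (deriv φ)) :=
    (ContDiff.deriv' (n := 1) (by rwa [one_add_one_eq_two])).continuous_deriv le_rfl
  have r3 := hre u (fun t => (c ^ 2)⁻¹ * deriv (deriv φ) t + μ t * φ t) hsol.locallyIntegrable hu
    ((hφ''.const_mul _).continuousOn.add
      ((hμ.mono Icc_subset_Ici_self).mul hφ.continuous.continuousOn))
  have r4 := hre h φ hsol.locallyIntegrable_force hh hφ.continuous.continuousOn
  have hfin := congrArg Complex.re hweak
  rw [Complex.add_re, Complex.add_re, Complex.sub_re, r3, r4] at hfin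
  have hcc : ((c : ℂ) ^ 2)⁻¹ = (((c ^ 2)⁻¹ : ℝ) : ℂ) := by push_cast; rfl
  rw [hcc, Complex.re_ofReal_mul, Complex.re_ofReal_mul, Complex.re_mul_ofReal,
    Complex.re_mul_ofReal] at hfin
  simpa using hfin

theorem ae_integrable_slice {n : ℕ} {f : ℝ × Space n → ℂ} {r : ℝ → ℝ}
    (hf : LocallyIntegrableOn f (halfSpace n))
    (hr : ∀ s t, 0 ≤ s → s ≤ t → r s ≤ r t)
    (hfs : ∀ᵐ z ∂(volume.restrict (halfSpace n)), r z.1 < ‖z.2‖ → f z = 0) :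
    ∀ᵐ t, t ∈ Ici (0 : ℝ) → Integrable fun x => f (t, x) := by
  have h : ∀ T : ℕ, ∀ᵐ t, t ∈ Icc (0 : ℝ) T → Integrable fun x => f (t, x) := fun T =>
    (ae_restrict_iff' measurableSet_Icc).1
      (integrable_of_finiteSpeed hf (fun t ht => hr t T ht.1 ht.2) hfs).prod_right_ae
  filter_upwards [ae_all_iff.2 h] with t ht ht0
  obtain ⟨T, hT⟩ := exists_nat_ge t
  exact ht T ⟨ht0, hT⟩

/-! ### Exponents in the three cases. -/

/-- What the three cases have in common. -/
theorem common_of_case {n : ℕ} (hn : 1 ≤ n) {c p σ H N : ℝ} {m : ℂ}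
    (hcase : CaseStatic n H p N m ∨ CaseExpanding n c σ H p N m ∨ CaseContracting n c σ H p N m) :
    m.re = 0 ∧ (H = 0 ∨ σ ≠ -1) ∧ 0 ≤ scaleRate n σ H ∧ 0 ≤ N ∧
      (0 ≤ σ * (n * H / (2 * c)) ^ 2 ∧ N ^ 2 = -(m ^ 2).re ∨
        σ * (n * H / (2 * c)) ^ 2 ≤ 0 ∧ N ^ 2 = -(m ^ 2).re - σ * (n * H / (2 * c)) ^ 2) := by
  have hn0 : (0 : ℝ) < n := by exact_mod_cast hn
  have hsqrt : ∀ {m : ℂ}, m.re = 0 → σ < 0 →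
      √(-(m ^ 2).re - σ * (n * H / (2 * c)) ^ 2) ^ 2
        = -(m ^ 2).re - σ * (n * H / (2 * c)) ^ 2 := by
    intro m hm hσ
    apply Real.sq_sqrt
    rw [re_sq_eq_neg_norm_sq hm]
    nlinarith [sq_nonneg ‖m‖, mul_nonneg (neg_pos.2 hσ).le (sq_nonneg (n * H / (2 * c)))]
  rcases hcase with ⟨rfl, hm, rfl, -, -⟩ | ⟨hH, hσ, hm, hN, -, -⟩ | ⟨hH, hσ, hm, rfl, -, -⟩
  · exact ⟨hm, Or.inl rfl, by simp [scaleRate], norm_nonneg _,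
      Or.inl ⟨by simp, by rw [re_sq_eq_neg_norm_sq hm, neg_neg]⟩⟩
  · have hκ : 0 ≤ scaleRate n σ H := by
      have : 0 ≤ 1 + σ := by linarith
      unfold scaleRate; positivity
    refine ⟨hm, Or.inr hσ.ne', hκ, ?_⟩
    rcases hN with ⟨hσ0, -, rfl⟩ | ⟨rfl, rfl⟩ | ⟨hσ0, rfl⟩
    · exact ⟨norm_nonneg _, Or.inl ⟨by positivity, by rw [re_sq_eq_neg_norm_sq hm, neg_neg]⟩⟩
    · exact ⟨norm_nonneg _, Or.inl ⟨by simp, by rw [re_sq_eq_neg_norm_sq hm, neg_neg]⟩⟩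
    · exact ⟨Real.sqrt_nonneg _,
        Or.inr ⟨mul_nonpos_of_nonpos_of_nonneg hσ0.le (sq_nonneg _), hsqrt hm hσ0⟩⟩
  · have h2n : 0 < 2 / (n : ℝ) := by positivity
    have hσ1 : 1 + σ < 0 := by linarith
    have hκ : 0 ≤ scaleRate n σ H := by
      have := mul_pos_of_neg_of_neg hσ1 hH
      unfold scaleRate
      rw [mul_assoc]; positivity
    exact ⟨hm, Or.inr (by linarith), hκ, Real.sqrt_nonneg _,
      Or.inr ⟨mul_nonpos_of_nonpos_of_nonneg (by linarith) (sq_nonneg _), hsqrt hm (by linarith)⟩⟩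

/-- If `N = 0` then the scale function is constant or `σ = 0`, with a subcritical exponent. -/
theorem pos_or_subcritical_of_case {n : ℕ} (hn : 1 ≤ n) {c p σ H N : ℝ} (hc : 0 < c) {m : ℂ}
    (hcase : CaseStatic n H p N m ∨ CaseExpanding n c σ H p N m ∨ CaseContracting n c σ H p N m) :
    0 < N ∨ (H = 0 ∧ n * (p - 1) < p + 1) ∨
      (0 < H ∧ σ = 0 ∧ (n ≤ 2 ∨ 3 ≤ n ∧ (n - 1) * (p - 1) < p + 1)) := by
  have hn0 : (0 : ℝ) < n := by exact_mod_cast hn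
  have hsqrt : ∀ {m : ℂ}, m.re = 0 → σ < 0 → H ≠ 0 →
      0 < √(-(m ^ 2).re - σ * (n * H / (2 * c)) ^ 2) := by
    intro m hm hσ hH
    apply Real.sqrt_pos.2
    rw [re_sq_eq_neg_norm_sq hm]
    have : 0 < (n * H / (2 * c)) ^ 2 := by positivity
    nlinarith [sq_nonneg ‖m‖, mul_pos (neg_pos.2 hσ) this]
  rcases hcase with ⟨rfl, hm, rfl, hp, hpn⟩ | ⟨hH, hσ, hm, hN, hp, hpn⟩ | ⟨hH, hσ, hm, rfl, -, -⟩
  · refine Or.inr (Or.inl ⟨rfl, ?_⟩)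
    rcases hpn with rfl | ⟨hn2, hpn⟩
    · norm_num; linarith
    · have h1 : (0 : ℝ) < n - 1 := by
        have : (2 : ℝ) ≤ n := by exact_mod_cast hn2
        linarith
      have h2 : p - 1 < 2 / ((n : ℝ) - 1) := by linarith
      rw [lt_div_iff₀ h1] at h2
      linarith
  · rcases hN with ⟨hσ0, hmN, rfl⟩ | ⟨rfl, rfl⟩ | ⟨hσ0, rfl⟩
    · left
      refine lt_of_lt_of_le ?_ hmN
      have := Real.sqrt_pos.2 hσ0
      positivity
    · refine Or.inr (Or.inr ⟨hH, rfl, ?_⟩)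
      rcases le_or_gt n 2 with h2 | h3
      · exact Or.inl h2
      refine Or.inr ⟨h3, ?_⟩
      have hn3 : (3 : ℝ) ≤ n := by exact_mod_cast h3
      have h2n : 2 / (n : ℝ) < 1 := by rw [div_lt_one hn0]; linarith
      -- For `n ≥ 3` and `σ = 0` only the branch `σ > -1 + 2/n` survives; there `p < n/(n-2)`, that
      -- is `(n-1)(p-1) < p + 1`.
      rcases hpn with ⟨h, -⟩ | ⟨h, -⟩ | ⟨-, -, h⟩ | ⟨-, h, -⟩ | ⟨h, -⟩ | ⟨-, h, -⟩
      · omega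
      · omega
      · rw [lt_div_iff₀ (by linarith)] at h
        linarith
      · linarith
      · omega
      · linarith
    · exact Or.inl (hsqrt hm hσ0 hH.ne')
  · have h2n : 0 < 2 / (n : ℝ) := by positivity
    exact Or.inl (hsqrt hm (by linarith) hH.ne)

/-- If `a r²` grows at most like `(1 + t)^k`, then `b` decays no faster than the power `-k n
(p-1)/2`. For `H = 0`, `k = 2`; otherwise `k = α + 2γ`, with any admissible `γ` if `N > 0`. -/
theorem exists_scale_mul_radius_sq_le_of_case {n : ℕ} (hn : 1 ≤ n) {c a₀ r₀ p σ H N : ℝ} {m : ℂ}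
    (hc : 0 < c) (ha₀ : 0 < a₀) (hr₀ : 0 < r₀) (hp : 1 < p)
    (hcase : CaseStatic n H p N m ∨ CaseExpanding n c σ H p N m ∨ CaseContracting n c σ H p N m) :
    ∃ C > 0, ∃ k : ℝ, 0 ≤ k ∧ (0 < N ∨ k * (n * (p - 1) / 2) < p + 1) ∧ ∀ t, 0 ≤ t →
      scale n σ H a₀ t * radius c r₀ (scale n σ H a₀) t ^ 2 ≤ C * (1 + t) ^ k := by
  obtain ⟨-, hσ, hκ, -, -⟩ := common_of_case hn hcase
  have hsub := pos_or_subcritical_of_case hn hc hcase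
  have hn0 : (0 : ℝ) < n := by exact_mod_cast hn
  have hp1 : 0 < p - 1 := by linarith
  by_cases hH : H = 0
  · subst hH
    refine ⟨a₀ * (r₀ + c / a₀) ^ 2, by positivity, 2, by norm_num, ?_, fun t ht => ?_⟩
    · rcases hsub with h | ⟨-, h⟩ | ⟨h, -⟩
      · exact Or.inl h
      · right; linarith
      · exact absurd h (lt_irrefl _)
    · have h1 : scale n σ 0 a₀ t = a₀ := by simp [scale]
      have h2 := radius_le_of_static (n := n) (σ := σ) hc ha₀ hr₀ ht
      have h3 : 0 ≤ radius c r₀ (scale n σ 0 a₀) t :=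
        hr₀.le.trans (le_radius (Or.inl rfl) hc hκ ha₀ ht)
      rw [h1, Real.rpow_two]
      calc a₀ * radius c r₀ (scale n σ 0 a₀) t ^ 2 ≤ a₀ * ((r₀ + c / a₀) * (1 + t)) ^ 2 := by
            gcongr
        _ = _ := by ring
  · have hκ0 : 0 < scaleRate n σ H := by
      refine lt_of_le_of_ne hκ fun h0 => ?_
      have := scaleExponent_mul_scaleRate hn hσ
      rw [← h0, mul_zero] at this
      exact hH this.symm
    set α := scaleExponent n σ H with hα
    suffices hγ : ∃ γ : ℝ, 0 < γ ∧ 1 - α ≤ γ ∧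
        (0 < N ∨ (α + 2 * γ) * (n * (p - 1) / 2) < p + 1) by
      obtain ⟨γ, hγ0, hγα, hγp⟩ := hγ
      obtain ⟨C, hC, hle⟩ := exists_scale_mul_radius_sq_le (r₀ := r₀) hσ hc hκ0 ha₀ hr₀ hγ0 hγα
      exact ⟨C, hC, α + 2 * γ, by linarith, hγp, hle⟩
    rcases hsub with h | ⟨h, -⟩ | ⟨-, rfl, h⟩
    · exact ⟨|1 - α| + 1, by positivity, by linarith [le_abs_self (1 - α)], Or.inl h⟩
    · exact absurd h hH
    · have hα' : α = 2 / n := by simp [hα, scaleExponent, hH]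
      rcases h with h | ⟨h3, h⟩
      -- Here `α = 2/n ≥ 1`, so any `γ > 0` is allowed; this one makes the decay exponent equal to
      -- `p`.
      · refine ⟨1 / (n * (p - 1)), by positivity, ?_, Or.inr ?_⟩
        · have h1 : 1 ≤ 2 / (n : ℝ) := by
            rw [one_le_div hn0]; exact_mod_cast h
          have : 0 < 1 / (n * (p - 1)) := by positivity
          rw [hα']; linarith
        · rw [hα']
          have : (2 / (n : ℝ) + 2 * (1 / (n * (p - 1)))) * (n * (p - 1) / 2) = p := by
            field_simp; ring
          linarith
      · have hn3 : (3 : ℝ) ≤ n := by exact_mod_cast h3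
        have h2n : 2 / (n : ℝ) < 1 := by rw [div_lt_one hn0]; linarith
        refine ⟨1 - α, by rw [hα']; linarith, le_rfl, Or.inr ?_⟩
        have : (α + 2 * (1 - α)) * (n * (p - 1) / 2) = (n - 1) * (p - 1) := by
          rw [hα']; field_simp; ring
        linarith

/-! ### The pointwise inequality for the average. -/

theorem coeffB_eq {n : ℕ} {c lam p r₀ t : ℝ} {a : ℝ → ℝ} (ha : 0 < a t)
    (hr : 0 < radius c r₀ a t) :
    coeffB n c lam p r₀ a t = lam * a t ^ (-(n * (p - 1) / 2))
      / (unitBallVolume n * radius c r₀ a t ^ n) ^ (p - 1) := by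
  have hω := unitBallVolume_pos n
  rw [coeffB, Real.mul_rpow ha.le (by positivity), Real.mul_rpow hω.le (by positivity),
    Real.rpow_neg ha.le, ← Real.rpow_natCast _ n, ← Real.rpow_mul hr.le, ← Real.rpow_natCast _ 2,
    ← Real.rpow_mul hr.le]
  have : ((2 : ℕ) : ℝ) * (n * (p - 1) / 2) = n * (p - 1) := by push_cast; ring
  rw [this]
  field_simp

/-- Multiplying the bound on the threshold function by `e^{cNt}` gives `X^{1/(p-1)} ≤ W` with `X =
(N² + μ)/((1-θ) b)`; raise to the power `p - 1` and multiply by `W`. -/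
theorem thresholdFun_absorb {n : ℕ} {c lam p r₀ N θ S W t μ : ℝ} {m : ℂ} {a : ℝ → ℝ}
    (hp : 1 < p) (hθ : θ < 1) (hB : 0 < coeffB n c lam p r₀ a t)
    (hμ : curvedMass n c m a t ^ 2 = (μ : ℂ)) (hNμ : 0 ≤ N ^ 2 + μ) (hW : 0 ≤ W)
    (hS : thresholdFun n c lam p r₀ N θ m a t ≤ S)
    (hSW : S * Real.exp (c * N * t) ≤ W) :
    (N ^ 2 + μ) * W ≤ (1 - θ) * coeffB n c lam p r₀ a t * W ^ p := by
  have hp1 : 0 < p - 1 := by linarith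
  rcases hW.eq_or_lt with rfl | hW0
  · rw [Real.zero_rpow (by linarith)]; simp
  have hθ1 : 0 < 1 - θ := by linarith
  rw [thresholdFun, hμ, Complex.ofReal_re] at hS
  set X := (N ^ 2 + μ) / ((1 - θ) * coeffB n c lam p r₀ a t) with hX
  have hX0 : 0 ≤ X := by positivity
  have h1 : X ^ (1 / (p - 1)) ≤ W := by
    calc X ^ (1 / (p - 1))
        = Real.exp (-(c * N * t)) * X ^ (1 / (p - 1)) * Real.exp (c * N * t) := by
          rw [mul_right_comm, ← Real.exp_add]; simp
      _ ≤ S * Real.exp (c * N * t) := by gcongr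
      _ ≤ W := hSW
  have h2 : X ≤ W ^ (p - 1) := by
    calc X = (X ^ (1 / (p - 1))) ^ (p - 1) := by
          rw [← Real.rpow_mul hX0, one_div_mul_cancel hp1.ne', Real.rpow_one]
      _ ≤ _ := by gcongr
  rw [hX, div_le_iff₀ (by positivity)] at h2
  calc (N ^ 2 + μ) * W ≤ W ^ (p - 1) * ((1 - θ) * coeffB n c lam p r₀ a t) * W := by gcongr
    _ = (1 - θ) * coeffB n c lam p r₀ a t * (W ^ (p - 1) * W ^ (1 : ℝ)) := by
        rw [Real.rpow_one]; ring
    _ = _ := by rw [← Real.rpow_add hW0, sub_add_cancel]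

theorem force_eq_zero {n : ℕ} {lam p : ℝ} {a : ℝ → ℝ} {u : ℝ × Space n → ℂ} {z : ℝ × Space n}
    (hp : 1 < p) (hz : u z = 0) : force n lam p a u z = 0 := by
  simp [force, hz, Real.zero_rpow (show p ≠ 0 by linarith)]

/-- The averaged nonlinearity dominates `b |w|^p`. -/
theorem coeffB_mul_rpow_le {n : ℕ} {c lam p r₀ t : ℝ} {a : ℝ → ℝ} {u : ℝ × Space n → ℂ}
    (hp : 1 < p) (hlam : 0 < lam) (ha : 0 < a t) (hr : 0 < radius c r₀ a t)
    (hu : Integrable fun x => u (t, x)) (hf : Integrable fun x => force n lam p a u (t, x))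
    (hsupp : ∀ᵐ x, radius c r₀ a t < ‖x‖ → u (t, x) = 0) :
    coeffB n c lam p r₀ a t * ‖∫ x, u (t, x)‖ ^ p ≤ -(∫ x, force n lam p a u (t, x)).re := by
  have hω := unitBallVolume_pos n
  set A := lam * a t ^ (-(n * (p - 1) / 2)) with hA
  have hA0 : 0 < A := by positivity
  have hfe : ∀ x, force n lam p a u (t, x) = ((-(A * ‖u (t, x)‖ ^ p) : ℝ) : ℂ) := fun x => rfl
  have hup : Integrable fun x => ‖u (t, x)‖ ^ p := by
    refine (hf.re.const_mul (-A⁻¹)).congr (Eventually.of_forall fun x => ?_)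
    simp only [hfe, RCLike.re_eq_complex_re, Complex.ofReal_re]
    field_simp
  have hint : -(∫ x, force n lam p a u (t, x)).re = A * ∫ x, ‖u (t, x)‖ ^ p := by
    simp only [hfe]
    rw [integral_complex_ofReal, Complex.ofReal_re, integral_neg, neg_neg, integral_const_mul]
  have h1 := norm_integral_rpow_le hp hr hu.1 hup hsupp
  have hV : 0 < (unitBallVolume n * radius c r₀ a t ^ n) ^ (p - 1) := by positivity
  rw [hint, coeffB_eq ha hr]
  calc _ ≤ A / (unitBallVolume n * radius c r₀ a t ^ n) ^ (p - 1)
        * ((unitBallVolume n * radius c r₀ a t ^ n) ^ (p - 1) * ∫ x, ‖u (t, x)‖ ^ p) := by gcongr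
    _ = _ := by field_simp

end FLRW

end

/-! ### Conclusion. -/

theorem corollary1p3 (n : ℕ) (hn : 1 ≤ n)
    (c a₀ lam p r₀ θ σ H N : ℝ) (m : ℂ)
    (hc : 0 < c) (ha₀ : 0 < a₀) (hlam : 0 < lam) (hp : 1 < p) (hr₀ : 0 < r₀)
    (hθ : 0 < θ) (hθ' : θ < 1)
    (u₀ u₁ : FLRW.Space n → ℂ)
    (hu₀ : MeasureTheory.Integrable u₀) (hu₁ : MeasureTheory.Integrable u₁)
    (hsupp₀ : ∀ᵐ x, r₀ < ‖x‖ → u₀ x = 0) (hsupp₁ : ∀ᵐ x, r₀ < ‖x‖ → u₁ x = 0)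
    (w₀ w₁ : ℝ) (hw₀ : w₀ = (∫ x, u₀ x).re) (hw₁ : w₁ = (∫ x, u₁ x).re)
    (hS : BddAbove (FLRW.thresholdSet n c lam p r₀ N θ m (FLRW.scale n σ H a₀)))
    (hw₀S : sSup (FLRW.thresholdSet n c lam p r₀ N θ m (FLRW.scale n σ H a₀)) < w₀)
    (hw₁w₀ : c * N * w₀ ≤ w₁)
    (hcase : FLRW.CaseStatic n H p N m ∨ FLRW.CaseExpanding n c σ H p N m ∨
      FLRW.CaseContracting n c σ H p N m) :
    ¬ ∃ u : ℝ × FLRW.Space n → ℂ,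
      FLRW.IsGlobalSolution n c lam p r₀ m (FLRW.scale n σ H a₀) u₀ u₁ u ∧
      ¬ u =ᵐ[MeasureTheory.volume.restrict (FLRW.halfSpace n)] 0 := by
  rintro ⟨u, ⟨hsol, hfs⟩, -⟩
  obtain ⟨hm, hσ, hκ, hN, hN2⟩ := FLRW.common_of_case hn hcase
  obtain ⟨C, hC, k, hk, hNk, hle⟩ :=
    FLRW.exists_scale_mul_radius_sq_le_of_case hn hc ha₀ hr₀ hp hcase
  set a := FLRW.scale n σ H a₀ with ha
  set S := sSup (FLRW.thresholdSet n c lam p r₀ N θ m a) with hSdef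
  set r := FLRW.radius c r₀ a with hr
  set b := FLRW.coeffB n c lam p r₀ a with hb
  let μ : ℝ → ℝ := fun t =>
    (m ^ 2).re + σ * (n * H / (2 * c)) ^ 2 / (1 + FLRW.scaleRate n σ H * t) ^ 2
  have hs : ∀ t, 0 ≤ t → 0 < 1 + FLRW.scaleRate n σ H * t := fun t => FLRW.one_add_mul_pos hκ
  have hapos : ∀ t, 0 ≤ t → 0 < a t := fun t ht => FLRW.scale_pos hσ ha₀ (hs t ht)
  have hrpos : ∀ t, 0 ≤ t → 0 < r t := fun t ht =>
    hr₀.trans_le (FLRW.le_radius hσ hc hκ ha₀ ht)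
  have hrmono : ∀ s t, 0 ≤ s → s ≤ t → r s ≤ r t := fun s t hs hst =>
    FLRW.radius_mono hσ hc hκ ha₀ hs hst
  have hr0 : r 0 = r₀ := by simp [hr, FLRW.radius]
  have hbpos : ∀ t, 0 ≤ t → 0 < b t := fun t ht =>
    FLRW.coeffB_pos hlam (hapos t ht) (hrpos t ht)
  have hM : ∀ t, 0 ≤ t → FLRW.curvedMass n c m a t ^ 2 = (μ t : ℂ) := fun t ht =>
    FLRW.curvedMass_sq hσ hn hc ha₀ hm (hs t ht)
  have hμc : ContinuousOn μ (Set.Ici 0) := by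
    refine continuousOn_const.add (continuousOn_const.div (by fun_prop) fun t ht => ?_)
    exact (pow_pos (hs t ht) 2).ne'
  -- With `A = σ (nH/2c)²` and `s = 1 + κ t ≥ 1`, the sum is `A/s²` when `A ≥ 0` and `A/s² - A` when
  -- `A ≤ 0`; both are nonnegative.
  have hNμ : ∀ t, 0 ≤ t → 0 ≤ N ^ 2 + μ t := by
    intro t ht
    rcases hN2 with ⟨h1, h2⟩ | ⟨h1, h2⟩
    · have : 0 ≤ σ * (n * H / (2 * c)) ^ 2 / (1 + FLRW.scaleRate n σ H * t) ^ 2 := by positivity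
      simp only [μ, h2]; linarith
    · have h3 : 1 ≤ (1 + FLRW.scaleRate n σ H * t) ^ 2 :=
        one_le_pow₀ (le_add_of_nonneg_right (mul_nonneg hκ ht))
      have h4 : σ * (n * H / (2 * c)) ^ 2
          ≤ σ * (n * H / (2 * c)) ^ 2 / (1 + FLRW.scaleRate n σ H * t) ^ 2 := by
        rw [le_div_iff₀ (by positivity)]
        nlinarith
      simp only [μ, h2]; linarith
  have hS0 : 0 ≤ S := by
    refine Real.sSup_nonneg ?_
    rintro _ ⟨t, ht, rfl⟩
    have ht0 : (0 : ℝ) ≤ t := le_of_lt ht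
    refine mul_nonneg (Real.exp_pos _).le (Real.rpow_nonneg (div_nonneg ?_ ?_) _)
    · rw [hM t ht0, Complex.ofReal_re]; exact hNμ t ht0
    · exact mul_nonneg (by linarith) (hbpos t ht0).le
  have hh : ∀ᵐ z ∂(MeasureTheory.volume.restrict (FLRW.halfSpace n)),
      r z.1 < ‖z.2‖ → FLRW.force n lam p a u z = 0 := by
    filter_upwards [hfs] with z hz hzr using FLRW.force_eq_zero hp (hz hzr)
  let W : ℝ → ℝ := fun t => (∫ x, u (t, x)).re
  let F : ℝ → ℝ := fun t => (∫ x, FLRW.force n lam p a u (t, x)).re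
  let G : ℝ → ℝ := fun t => c ^ 2 * (-F t - μ t * W t)
  have hWi : ∀ T, MeasureTheory.IntegrableOn W (Set.Icc 0 T) := fun T =>
    (FLRW.integrable_of_finiteSpeed hsol.locallyIntegrable
      (fun t ht => hrmono t T ht.1 ht.2) hfs).integral_prod_left.re
  have hFi : ∀ T, MeasureTheory.IntegrableOn F (Set.Icc 0 T) := fun T =>
    (FLRW.integrable_of_finiteSpeed hsol.locallyIntegrable_force
      (fun t ht => hrmono t T ht.1 ht.2) hh).integral_prod_left.re
  have hμWi : ∀ T, MeasureTheory.IntegrableOn (fun t => μ t * W t) (Set.Icc 0 T) := fun T =>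
    (hWi T).continuousOn_mul (hμc.mono Set.Icc_subset_Ici_self) isCompact_Icc
  have hGi : ∀ T, MeasureTheory.IntegrableOn G (Set.Icc 0 T) := fun T =>
    ((hFi T).neg.sub (hμWi T)).const_mul _
  have hind : ∀ (f : ℝ → ℝ) t, 0 ≤ t → (Set.Ici 0).indicator f t = f t := fun f t ht =>
    Set.indicator_of_mem ht f
  -- `W` and `G` are controlled only for `t ≥ 0`; extension by zero makes them locally integrable on
  -- the line.
  refine FLRW.false_of_weak_ineq (ν := c * N) (S := S) (p := p) (w₀ := w₀) (w₁ := w₁)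
    (FLRW.locallyIntegrable_indicator_Ici hWi) (FLRW.locallyIntegrable_indicator_Ici hGi) hp
    (by positivity) (k := k * (n * (p - 1) / 2))
    (β := c ^ 2 * (θ * (lam / (FLRW.unitBallVolume n ^ (p - 1) * C ^ (n * (p - 1) / 2)))))
    ?_ ?_ hS0 hw₀S hw₁w₀ ?_ ?_ ?_
  · have : 0 ≤ p - 1 := by linarith
    positivity
  · have := FLRW.unitBallVolume_pos n
    positivity
  · exact hNk.imp_left fun h => mul_pos hc h
  · intro φ hφ T hT hφT
    have havg := FLRW.averaged_weak_eq hsol hT (hr0.symm ▸ hr₀.le)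
      (fun t ht => hrmono t T ht.1 ht.2) hfs hh (hr0.symm ▸ hsupp₀) (hr0.symm ▸ hsupp₁) hM hμc hφ
      hφT
    have hφc := hφ.continuous
    have hφ'' : Continuous (deriv (deriv φ)) :=
      (ContDiff.deriv' (n := 1) (by rwa [one_add_one_eq_two])).continuous_deriv le_rfl
    have hii : ∀ f g : ℝ → ℝ, MeasureTheory.IntegrableOn f (Set.Icc 0 T) → Continuous g →
        IntervalIntegrable (fun t => f t * g t) MeasureTheory.volume 0 T := fun f g hf hg =>
      ((intervalIntegrable_iff_integrableOn_Icc_of_le hT.le).2 hf).mul_continuousOn hg.continuousOn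
    have e1 : ∫ t in (0 : ℝ)..T, (∫ x, u (t, x)).re * ((c ^ 2)⁻¹ * deriv (deriv φ) t + μ t * φ t)
        = (c ^ 2)⁻¹ * (∫ t in (0 : ℝ)..T, W t * deriv (deriv φ) t)
          + ∫ t in (0 : ℝ)..T, μ t * W t * φ t := by
      rw [← intervalIntegral.integral_const_mul, ← intervalIntegral.integral_add
        ((hii _ _ (hWi T) hφ'').const_mul _) (hii _ _ (hμWi T) hφc)]
      refine intervalIntegral.integral_congr fun t _ => ?_
      simp only [W]; ring
    have e2 : ∫ t in (0 : ℝ)..T, G t * φ t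
        = c ^ 2 * (-(∫ t in (0 : ℝ)..T, F t * φ t) - ∫ t in (0 : ℝ)..T, μ t * W t * φ t) := by
      have hneg : IntervalIntegrable (fun t => -(F t * φ t)) MeasureTheory.volume 0 T :=
        (hii _ _ (hFi T) hφc).neg
      rw [← intervalIntegral.integral_neg, ← intervalIntegral.integral_sub hneg (hii _ _ (hμWi T) hφc), ← intervalIntegral.integral_const_mul]
      refine intervalIntegral.integral_congr fun t _ => ?_
      simp only [G]; ring
    have e3 : ∀ f g : ℝ → ℝ, ∫ t in (0 : ℝ)..T, (Set.Ici 0).indicator f t * g t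
        = ∫ t in (0 : ℝ)..T, f t * g t := by
      intro f g
      refine intervalIntegral.integral_congr fun t ht => ?_
      rw [Set.uIcc_of_le hT.le] at ht
      simp only [hind f t ht.1]
    rw [e3, e3, e2]
    rw [e1, ← hw₀, ← hw₁] at havg
    have hcc : c ^ 2 * (c ^ 2)⁻¹ = 1 := mul_inv_cancel₀ (by positivity)
    linear_combination c ^ 2 * havg
      - (w₀ * deriv φ 0 - w₁ * φ 0 + ∫ t in (0 : ℝ)..T, W t * deriv (deriv φ) t) * hcc
  · filter_upwards [FLRW.ae_integrable_slice hsol.locallyIntegrable hrmono hfs,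
      FLRW.ae_integrable_slice hsol.locallyIntegrable_force hrmono hh,
      FLRW.ae_slice_of_ae_halfSpace hfs] with t h1 h2 h3 ht
    have ht0 : 0 ≤ t := le_of_lt ht
    rw [hind W t ht0, hind G t ht0]
    intro hSW
    have hW0 : 0 ≤ W t := le_trans (by positivity) hSW
    have hF := FLRW.coeffB_mul_rpow_le hp hlam (hapos t ht0) (hrpos t ht0) (h1 ht0) (h2 ht0)
      (h3 ht0)
    have hWF : b t * W t ^ p ≤ -F t := by
      refine le_trans (mul_le_mul_of_nonneg_left ?_ (hbpos t ht0).le) hF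
      exact Real.rpow_le_rpow hW0 (Complex.re_le_norm _) (by linarith)
    have habs := FLRW.thresholdFun_absorb hp hθ' (hbpos t ht0) (hM t ht0) (hNμ t ht0) hW0
      (le_csSup hS ⟨t, ht, rfl⟩) hSW
    have hb' := FLRW.coeffB_ge (n := n) hlam hp (hapos t ht0) (hrpos t ht0) hC ht0 (hle t ht0)
    have hb'' := mul_le_mul_of_nonneg_right hb'
      (mul_nonneg hθ.le (Real.rpow_nonneg hW0 p))
    -- Split `b W^p` into the shares `1 - θ` and `θ`: the first absorbs `(N² + μ) W`, the second
    -- keeps the polynomial lower bound of `b`.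
    have hfin : N ^ 2 * W t + θ * (lam / (FLRW.unitBallVolume n ^ (p - 1)
        * C ^ (n * (p - 1) / 2))) * (1 + t) ^ (-(k * (n * (p - 1) / 2))) * W t ^ p
        ≤ -F t - μ t * W t := by
      linarith
    have := mul_le_mul_of_nonneg_left hfin (sq_nonneg c)
    simp only [G]
    linarith
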